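/- Let $G_{5,3}$ be the simply connected nilpotent Lie group $\mathbb R^5$ with multiplication $$x\cdot y=\bigl(x_1+y_1+x_4y_3+x_5y_2+\tfrac12x_5^2y_4,\;x_2+y_2+x_5y_4,\;x_3+y_3,\;x_4+y_4,\;x_5+y_5\bigr),$$ whose center is $Z=\mathbb R\times\{(0,0,0,0)\}$. For $\lambda\in\mathbb R\setminus\{0\}$ let $\pi_\lambda$ be the representation of $G_{5,3}$ given on functions on $\mathbb R^2$ by $$\pi_\lambda(x)g(s,t)=\exp\Bigl(2\pi i\lambda\bigl(x_1-x_3x_4+x_4s-x_2t+\tfrac12x_4t^2\bigr)\Bigr)\,g(s-x_3,t-x_5).$$ Let $g,\gamma\in\mathcal S(\mathbb R^2)$ be non-zero, and for $p,q\in[1,\infty]$ let $$Co_{\pi_\lambda}L^p(G_{5,3}/Z)=\{f\in\mathcal S'(\mathbb R^2):\ (x_2,x_3,x_4,x_5)\mapsto\langle f,\pi_\lambda(0,x_2,x_3,x_4,x_5)g\rangle\ \text{is in}\ L^p(\mathbb R^4)\}$$ be the coorbit space of $\pi_\lambda$ with window $g$, and let $$M^q(\mathbb R^2)=\{f\in\mathcal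 S'(\mathbb R^2):\ (x,\xi)\mapsto\langle f,M_\xi T_x\gamma\rangle\ \text{is in}\ L^q(\mathbb R^4)\},\qquad M_\xi T_x\gamma(z)=e^{2\pi i\xi\cdot z}\gamma(z-x),$$ be the modulation space with window $\gamma$, where $\langle f,h\rangle=f(\bar h)$ for $f\in\mathcal S'(\mathbb R^2)$, $h\in\mathcal S(\mathbb R^2)$. If $p,q\in[1,\infty]$ and $p\neq2$, then $$Co_{\pi_\lambda}L^p(G_{5,3}/Z)\neq M^q(\mathbb R^2)$$ as subspaces of $\mathcal S'(\mathbb R^2)$. -/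

import Mathlib

open scoped SchwartzMap ENNReal

noncomputable section

/-! ### Phase functions, translation and modulation on `𝓢(ℝ²)`

`ℝ²` is `ℝ × ℝ` with Lebesgue measure; a point is written `z = (s, t)`. -/

/-- `y ↦ e^{2πiy}` on `ℝ` is smooth with bounded derivatives. -/
theorem hasTemperateGrowth_expTwoPiI :
    Function.HasTemperateGrowth
      (fun y : ℝ => Complex.exp (2 * (Real.pi : ℂ) * Complex.I * (y : ℂ))) := by
  have hd : ∀ n : ℕ, iteratedDeriv n
      (fun y : ℝ => Complex.exp (2 * (Real.pi : ℂ) * Complex.I * (y : ℂ))) =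
      fun y : ℝ => (2 * (Real.pi : ℂ) * Complex.I) ^ n *
        Complex.exp (2 * (Real.pi : ℂ) * Complex.I * (y : ℂ)) := by
    intro n
    induction n with
    | zero => simp
    | succ n ih =>
      rw [iteratedDeriv_succ, ih]
      funext y
      have h1 : HasDerivAt (fun y : ℝ => 2 * (Real.pi : ℂ) * Complex.I * (y : ℂ))
          (2 * (Real.pi : ℂ) * Complex.I * 1) y :=
        (Complex.ofRealCLM.hasDerivAt (x := y)).const_mul _
      rw [((h1.cexp).const_mul _).deriv]
      ring
  refine ⟨?_, fun n => ⟨0, (2 * Real.pi) ^ n, fun y => ?_⟩⟩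
  · exact Complex.contDiff_exp.comp (contDiff_const.mul Complex.ofRealCLM.contDiff)
  · rw [norm_iteratedFDeriv_eq_norm_iteratedDeriv, hd]
    have : ‖Complex.exp (2 * (Real.pi : ℂ) * Complex.I * (y : ℂ))‖ = 1 := by
      rw [show 2 * (Real.pi : ℂ) * Complex.I * (y : ℂ) = ((2 * Real.pi * y : ℝ) : ℂ) * Complex.I by
        push_cast; ring]
      exact Complex.norm_exp_ofReal_mul_I _
    simp [this, abs_of_pos Real.pi_pos]

/-- The function `z ↦ e^{2πi P(z)}` on `ℝ²` attached to a real phase `P`. -/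
def phaseFun (P : ℝ × ℝ → ℝ) (z : ℝ × ℝ) : ℂ :=
  Complex.exp (2 * (Real.pi : ℂ) * Complex.I * (P z : ℂ))

theorem hasTemperateGrowth_phaseFun {P : ℝ × ℝ → ℝ} (hP : P.HasTemperateGrowth) :
    (phaseFun P).HasTemperateGrowth :=
  hasTemperateGrowth_expTwoPiI.comp hP

theorem hasTemperateGrowth_fst : Function.HasTemperateGrowth (fun z : ℝ × ℝ => z.1) :=
  (ContinuousLinearMap.fst ℝ ℝ ℝ).hasTemperateGrowth

theorem hasTemperateGrowth_snd : Function.HasTemperateGrowth (fun z : ℝ × ℝ => z.2) :=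
  (ContinuousLinearMap.snd ℝ ℝ ℝ).hasTemperateGrowth

/-- Translation `T_x g (z) = g (z - x)`. -/
def transl (x : ℝ × ℝ) : 𝓢(ℝ × ℝ, ℂ) →L[ℂ] 𝓢(ℝ × ℝ, ℂ) :=
  SchwartzMap.compSubConstCLM ℂ x

/-- Multiplication of a Schwartz function by `e^{2πi P}`, for a phase `P` of temperate growth. -/
def phaseMul (P : ℝ × ℝ → ℝ) : 𝓢(ℝ × ℝ, ℂ) →L[ℂ] 𝓢(ℝ × ℝ, ℂ) :=
  SchwartzMap.smulLeftCLM ℂ (phaseFun P)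

theorem phaseMul_apply {P : ℝ × ℝ → ℝ} (hP : P.HasTemperateGrowth) (g : 𝓢(ℝ × ℝ, ℂ))
    (z : ℝ × ℝ) :
    phaseMul P g z = Complex.exp (2 * (Real.pi : ℂ) * Complex.I * (P z : ℂ)) * g z :=
  SchwartzMap.smulLeftCLM_apply_apply (hasTemperateGrowth_phaseFun hP) g z

/-- Modulation `M_ξ g (z) = e^{2πi ξ·z} g(z)`. -/
def modul (ξ : ℝ × ℝ) : 𝓢(ℝ × ℝ, ℂ) →L[ℂ] 𝓢(ℝ × ℝ, ℂ) :=
  phaseMul (fun z => ξ.1 * z.1 + ξ.2 * z.2)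

theorem modul_apply (ξ : ℝ × ℝ) (g : 𝓢(ℝ × ℝ, ℂ)) (z : ℝ × ℝ) :
    modul ξ g z = Complex.exp (2 * (Real.pi : ℂ) * Complex.I *
      ((ξ.1 * z.1 + ξ.2 * z.2 : ℝ) : ℂ)) * g z :=
  phaseMul_apply (P := fun z => ξ.1 * z.1 + ξ.2 * z.2)
    (((Function.HasTemperateGrowth.const _).mul hasTemperateGrowth_fst).add
      ((Function.HasTemperateGrowth.const _).mul hasTemperateGrowth_snd)) g z

/-- Pointwise complex conjugation of a Schwartz function. -/
def schwartzConj (g : 𝓢(ℝ × ℝ, ℂ)) : 𝓢(ℝ × ℝ, ℂ) :=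
  SchwartzMap.postcompCLM (Complex.conjCLE : ℂ →L[ℝ] ℂ) g

theorem schwartzConj_apply (g : 𝓢(ℝ × ℝ, ℂ)) (z : ℝ × ℝ) :
    schwartzConj g z = (starRingEnd ℂ) (g z) := rfl

/-- The pairing `⟨f, g⟩` of a tempered distribution with a Schwartz function, linear in `f` and
antilinear in `g`; it extends `⟨f, g⟩ = ∫ f(z) conj(g(z)) dz`. -/
def sesqPairing (f : 𝓢'(ℝ × ℝ, ℂ)) (g : 𝓢(ℝ × ℝ, ℂ)) : ℂ :=
  f (schwartzConj g)

/-! ### Modulation spaces -/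

/-- The short-time Fourier transform `S_g f (x, ξ) = ⟨f, M_ξ T_x g⟩`. -/
def stft (g : 𝓢(ℝ × ℝ, ℂ)) (f : 𝓢'(ℝ × ℝ, ℂ)) (w : (ℝ × ℝ) × (ℝ × ℝ)) : ℂ :=
  sesqPairing f (modul w.2 (transl w.1 g))

/-- The modulation space `M^q(ℝ²)` with window `g`: the tempered distributions `f` with
`S_g f ∈ L^q(ℝ⁴)`. -/
def modulationSpace (g : 𝓢(ℝ × ℝ, ℂ)) (q : ℝ≥0∞) : Submodule ℂ 𝓢'(ℝ × ℝ, ℂ) where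
  carrier := {f | MeasureTheory.MemLp (stft g f) q MeasureTheory.volume}
  zero_mem' := MeasureTheory.MemLp.zero
  add_mem' := fun ha hb => MeasureTheory.MemLp.add ha hb
  smul_mem' := fun c _ hf => MeasureTheory.MemLp.const_smul hf c

/-! ### The group `G_{5,3}` and its representations -/

/-- The simply connected nilpotent Lie group `G_{5,3}`, in global coordinates on `ℝ⁵`. -/
@[ext] structure G53 where
  x1 : ℝ
  x2 : ℝ
  x3 : ℝ
  x4 : ℝ
  x5 : ℝ

namespace G53

instance : Mul G53 :=
  ⟨fun x y => ⟨x.x1 + y.x1 + x.x4 * y.x3 + x.x5 * y.x2 + 1 / 2 * x.x5 ^ 2 * y.x4,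
    x.x2 + y.x2 + x.x5 * y.x4, x.x3 + y.x3, x.x4 + y.x4, x.x5 + y.x5⟩⟩

instance : One G53 := ⟨⟨0, 0, 0, 0, 0⟩⟩

instance : Inv G53 :=
  ⟨fun x => ⟨-x.x1 + x.x3 * x.x4 + x.x2 * x.x5 - 1 / 2 * x.x4 * x.x5 ^ 2,
    -x.x2 + x.x4 * x.x5, -x.x3, -x.x4, -x.x5⟩⟩

theorem mul_def (x y : G53) :
    x * y = ⟨x.x1 + y.x1 + x.x4 * y.x3 + x.x5 * y.x2 + 1 / 2 * x.x5 ^ 2 * y.x4,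
      x.x2 + y.x2 + x.x5 * y.x4, x.x3 + y.x3, x.x4 + y.x4, x.x5 + y.x5⟩ := rfl

theorem one_def : (1 : G53) = ⟨0, 0, 0, 0, 0⟩ := rfl

theorem inv_def (x : G53) :
    x⁻¹ = ⟨-x.x1 + x.x3 * x.x4 + x.x2 * x.x5 - 1 / 2 * x.x4 * x.x5 ^ 2,
      -x.x2 + x.x4 * x.x5, -x.x3, -x.x4, -x.x5⟩ := rfl

instance : Group G53 :=
  Group.ofLeftAxioms
    (fun x y z => by ext <;> simp only [mul_def] <;> ring)
    (fun x => by ext <;> simp [mul_def, one_def])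
    (fun x => by ext <;> simp only [mul_def, one_def, inv_def] <;> ring)

/-- The centre of `G_{5,3}` is `ℝ × {(0, 0, 0, 0)}`. -/
theorem mem_center_iff (x : G53) :
    x ∈ Subgroup.center G53 ↔ x.x2 = 0 ∧ x.x3 = 0 ∧ x.x4 = 0 ∧ x.x5 = 0 := by
  rw [Subgroup.mem_center_iff]
  constructor
  · intro h
    have h2 := h ⟨0, 1, 0, 0, 0⟩
    have h3 := h ⟨0, 0, 1, 0, 0⟩
    have h4 := h ⟨0, 0, 0, 1, 0⟩
    have h5 := h ⟨0, 0, 0, 0, 1⟩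
    simp only [mul_def, G53.mk.injEq] at h2 h3 h4 h5
    refine ⟨?_, ?_, ?_, ?_⟩ <;> nlinarith [h2.1, h3.1, h4.1, h5.1, h4.2.1, h5.2.1]
  · rintro ⟨h2, h3, h4, h5⟩ y
    ext <;> simp only [mul_def, h2, h3, h4, h5] <;> ring

/-- The section `(x₂, x₃, x₄, x₅) ↦ (0, x₂, x₃, x₄, x₅)` of `G_{5,3} → G_{5,3}/Z`; in these
coordinates the Haar measure of `G_{5,3}/Z` is Lebesgue measure on `ℝ⁴`. -/
def sec (w : ℝ × ℝ × ℝ × ℝ) : G53 := ⟨0, w.1, w.2.1, w.2.2.1, w.2.2.2⟩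

/-- The real phase of `π_λ(x)`. -/
def repPhase (l : ℝ) (x : G53) (z : ℝ × ℝ) : ℝ :=
  l * (x.x1 - x.x3 * x.x4 + x.x4 * z.1 - x.x2 * z.2 + 1 / 2 * x.x4 * z.2 ^ 2)

theorem hasTemperateGrowth_repPhase (l : ℝ) (x : G53) : (repPhase l x).HasTemperateGrowth := by
  have h1 := hasTemperateGrowth_fst
  have h2 := hasTemperateGrowth_snd
  have hc : ∀ c : ℝ, Function.HasTemperateGrowth (fun _ : ℝ × ℝ => c) :=
    Function.HasTemperateGrowth.const
  exact (hc l).mul (((((hc (x.x1 - x.x3 * x.x4)).add ((hc x.x4).mul h1)).sub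
    ((hc x.x2).mul h2))).add ((hc (1 / 2 * x.x4)).mul (h2.pow 2)))

/-- The operator `π_λ(x)` on Schwartz functions,
`π_λ(x) g (s, t) = exp(2πiλ(x₁ - x₃x₄ + x₄s - x₂t + x₄t²/2)) g(s - x₃, t - x₅)`. -/
def repOp (l : ℝ) (x : G53) : 𝓢(ℝ × ℝ, ℂ) →L[ℂ] 𝓢(ℝ × ℝ, ℂ) :=
  (phaseMul (repPhase l x)).comp (transl (x.x3, x.x5))

theorem repOp_apply (l : ℝ) (x : G53) (g : 𝓢(ℝ × ℝ, ℂ)) (s t : ℝ) :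
    repOp l x g (s, t) =
      Complex.exp (2 * (Real.pi : ℂ) * Complex.I *
        ((l * (x.x1 - x.x3 * x.x4 + x.x4 * s - x.x2 * t + 1 / 2 * x.x4 * t ^ 2) : ℝ) : ℂ)) *
      g (s - x.x3, t - x.x5) :=
  phaseMul_apply (hasTemperateGrowth_repPhase l x) _ (s, t)

/-- The representation `π_λ` of `G_{5,3}`, restricted to its smooth vectors `𝓢(ℝ²)`. -/
def rep (l : ℝ) : G53 →* (𝓢(ℝ × ℝ, ℂ) →L[ℂ] 𝓢(ℝ × ℝ, ℂ)) where
  toFun := repOp l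
  map_one' := by
    ext g ⟨s, t⟩
    rw [repOp_apply]
    simp [one_def]
  map_mul' x y := by
    ext g ⟨s, t⟩
    rw [mul_apply_eq_comp, repOp_apply, repOp_apply, repOp_apply, ← mul_assoc,
      ← Complex.exp_add]
    simp only [mul_def]
    congr 2
    · push_cast
      ring
    · ext <;> ring

/-- The representation coefficient `V_g^{π_λ} f (x) = ⟨f, π_λ(x) g⟩`, `x ∈ G_{5,3}`. -/
def coeff (l : ℝ) (g : 𝓢(ℝ × ℝ, ℂ)) (f : 𝓢'(ℝ × ℝ, ℂ)) (x : G53) : ℂ :=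
  sesqPairing f (rep l x g)

/-- The coorbit space `Co_{π_λ} L^p(G_{5,3}/Z)` with window `g`: the tempered distributions `f`
with `V_g^{π_λ} f ∈ L^p(G_{5,3}/Z)`. -/
def coorbitSpace (l : ℝ) (g : 𝓢(ℝ × ℝ, ℂ)) (p : ℝ≥0∞) : Submodule ℂ 𝓢'(ℝ × ℝ, ℂ) where
  carrier := {f | MeasureTheory.MemLp (fun w => coeff l g f (sec w)) p MeasureTheory.volume}
  zero_mem' := MeasureTheory.MemLp.zero
  add_mem' := fun ha hb => MeasureTheory.MemLp.add ha hb
  smul_mem' := fun c _ hf => MeasureTheory.MemLp.const_smul hf c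

end G53

end

open scoped SchwartzMap ENNReal NNReal Topology LineDeriv
open MeasureTheory Filter

noncomputable section

/-! The test objects are the modulations `f_k = M_{(k,0)} γ` of the window `γ` itself. Modulation
only translates the short-time Fourier transform in frequency, so all `f_k` have the same finite,
nonzero norm in `M^q` (`memLp_stft_schwartzDist`, `eLpNorm_stft_schwartzDist_modul`,
`eLpNorm_stft_self_ne_zero`).

The representation `π_λ` sees them differently. Its coefficient at `x` is an oscillatory integral
whose phase has `s`-derivative `k - λx₄`. Away from `λx₄ ≈ k` this derivative is large; near it, the
term `λx₄t²/2` is a chirp in `t` of rate comparable to `k`. Either way the coefficient is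
`O(k^{-1/2})` uniformly in `x` (`exists_norm_coeff_modul_le`). In the coordinates `(s + t²/2, t)`
the phase is affine, so Plancherel shows that the `L²` norm of the coefficient does not depend on
`k` and is positive (`exists_lintegral_enorm_sq_coeff`). A fixed `L²` norm and a vanishing sup norm
force the `L^p` norm to tend to zero for `p > 2` and prevent it from staying bounded for `p < 2`.

An inclusion of spaces becomes a norm bound through `exists_eLpNorm_le_of_memLp_imp`, a closed graph
argument that needs no completeness of the coorbit or modulation spaces: it is run on `ℓ¹`, which
parametrises absolutely convergent superpositions of an equicontinuous sequence of distributions.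
For `p < 2` the sequence is `f_k`, and `M^q` is not contained in the coorbit space. For `p > 2` it
is `(j+1) f_{κ(j)}` with `κ(j)` growing fast enough to keep the coorbit norms at most one, and the
reverse inclusion fails. Equicontinuity after this rescaling comes from
`exists_norm_schwartzDist_modul_le`. -/

/-- An `L^p` limit agrees almost everywhere with an almost everywhere pointwise limit. -/
theorem ae_eq_of_tendsto_Lp {X : Type*} [MeasurableSpace X] {μ : Measure X} {p : ℝ≥0∞}
    [Fact (1 ≤ p)] {u : ℕ → Lp ℂ p μ} {S : Lp ℂ p μ} (hu : Tendsto u atTop (𝓝 S)) {v : X → ℂ}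
    (hv : ∀ᵐ x ∂μ, Tendsto (fun n => u n x) atTop (𝓝 (v x))) : S =ᵐ[μ] v := by
  obtain ⟨ns, hns, h⟩ := (tendstoInMeasure_of_tendsto_Lp hu).exists_seq_tendsto_ae
  filter_upwards [h, hv] with x hx hvx
  exact tendsto_nhds_unique hx (hvx.comp hns.tendsto_atTop)

/-! ### Closed graph argument on `ℓ¹` superpositions of tempered distributions -/

section

variable {E : Type*} [NormedAddCommGroup E] [NormedSpace ℝ E]

theorem summable_coeff_mul {F : ℕ → 𝓢'(E, ℂ)} {N : 𝓢(E, ℂ) → ℝ}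
    (hN : ∀ k ψ, ‖F k ψ‖ ≤ N ψ) (c : lp (fun _ : ℕ => ℂ) 1) (ψ : 𝓢(E, ℂ)) :
    Summable fun k => c k * F k ψ := by
  have hc : Summable fun k => ‖c k‖ := by
    simpa using (lp.memℓp c).summable (by simp)
  refine Summable.of_norm_bounded (hc.mul_right (N ψ)) fun k => ?_
  rw [norm_mul]
  gcongr
  exact hN k ψ

theorem norm_tsum_coeff_mul_le {F : ℕ → 𝓢'(E, ℂ)} {N : 𝓢(E, ℂ) → ℝ}
    (hN : ∀ k ψ, ‖F k ψ‖ ≤ N ψ) (c : lp (fun _ : ℕ => ℂ) 1) (ψ : 𝓢(E, ℂ)) :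
    ‖∑' k, c k * F k ψ‖ ≤ ‖c‖ * N ψ := by
  have hc : Summable fun k => ‖c k‖ := by
    simpa using (lp.memℓp c).summable (by simp)
  have hn : ‖c‖ = ∑' k, ‖c k‖ := by
    rw [lp.norm_eq_tsum_rpow (by simp)]; simp
  rw [hn, ← tsum_mul_right]
  refine tsum_of_norm_bounded (hc.mul_right (N ψ)).hasSum fun k => ?_
  rw [norm_mul]
  gcongr
  exact hN k ψ

/-- The superposition `∑ c_k F_k` of an equicontinuous sequence of tempered distributions with
absolutely summable coefficients. -/
def superposition (F : ℕ → 𝓢'(E, ℂ)) (N : Finset (ℕ × ℕ)) (C : ℝ) (hC : 0 ≤ C)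
    (hN : ∀ k ψ, ‖F k ψ‖ ≤ C * N.sup (schwartzSeminormFamily ℂ E ℂ) ψ)
    (c : lp (fun _ : ℕ => ℂ) 1) : 𝓢'(E, ℂ) :=
  ContinuousLinearMap.toPointwiseConvergenceCLM _ _ _ _
    (SchwartzMap.mkCLMtoNormedSpace (σ := RingHom.id ℂ) (fun ψ => ∑' k, c k * F k ψ)
      (fun f g => by
        rw [← (summable_coeff_mul hN c f).tsum_add (summable_coeff_mul hN c g)]
        simp [mul_add])
      (fun a f => by
        simp only [map_smul, smul_eq_mul, RingHom.id_apply, ← tsum_mul_left]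
        congr with k
        ring)
      ⟨N, ‖c‖ * C, by positivity, fun f => by
        rw [mul_assoc]; exact norm_tsum_coeff_mul_le hN c f⟩)

theorem superposition_apply (F : ℕ → 𝓢'(E, ℂ)) (N : Finset (ℕ × ℕ)) (C : ℝ) (hC : 0 ≤ C)
    (hN : ∀ k ψ, ‖F k ψ‖ ≤ C * N.sup (schwartzSeminormFamily ℂ E ℂ) ψ)
    (c : lp (fun _ : ℕ => ℂ) 1) (ψ : 𝓢(E, ℂ)) :
    superposition F N C hC hN c ψ = ∑' k, c k * F k ψ := rfl

/-- Absolutely summable superpositions of a bounded sequence of `L^p` coefficient functions have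
`L^p` coefficient functions. -/
theorem memLp_superposition {X : Type*} [MeasurableSpace X] {μ : Measure X} {p : ℝ≥0∞}
    [Fact (1 ≤ p)] (F : ℕ → 𝓢'(E, ℂ)) (N : Finset (ℕ × ℕ)) (C : ℝ) (hC : 0 ≤ C)
    (hN : ∀ k ψ, ‖F k ψ‖ ≤ C * N.sup (schwartzSeminormFamily ℂ E ℂ) ψ)
    (a : X → 𝓢(E, ℂ)) (hF : ∀ k, MemLp (fun x => F k (a x)) p μ) (B : ℝ≥0)
    (hB : ∀ k, eLpNorm (fun x => F k (a x)) p μ ≤ B) (c : lp (fun _ : ℕ => ℂ) 1) :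
    MemLp (fun x => superposition F N C hC hN c (a x)) p μ := by
  have hc : Summable fun k => ‖c k‖ := by
    simpa using (lp.memℓp c).summable (by simp)
  have hs : Summable fun k => c k • (hF k).toLp := by
    refine Summable.of_norm_bounded (hc.mul_right (B : ℝ)) fun k => ?_
    rw [norm_smul, Lp.norm_toLp]
    gcongr
    exact ENNReal.toReal_le_of_le_ofReal B.2 (by simpa using hB k)
  have hae : ∀ᵐ x ∂μ, Tendsto
      (fun n => (∑ k ∈ Finset.range n, c k • (hF k).toLp : Lp ℂ p μ) x) atTop
      (𝓝 (superposition F N C hC hN c (a x))) := by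
    have h1 : ∀ᵐ x ∂μ, ∀ n, (∑ k ∈ Finset.range n, c k • (hF k).toLp : Lp ℂ p μ) x
        = ∑ k ∈ Finset.range n, c k * F k (a x) := by
      rw [ae_all_iff]
      intro n
      have h2 : ∀ᵐ x ∂μ, ∀ k, (c k • (hF k).toLp : Lp ℂ p μ) x = c k * F k (a x) := by
        rw [ae_all_iff]
        intro k
        filter_upwards [Lp.coeFn_smul (c k) (hF k).toLp, (hF k).coeFn_toLp] with x h3 h4
        rw [h3, Pi.smul_apply, h4, smul_eq_mul]
      induction n with
      | zero =>
        filter_upwards [Lp.coeFn_zero ℂ p μ] with x hx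
        simpa using hx
      | succ n ih =>
        filter_upwards [ih, h2, Lp.coeFn_add (∑ k ∈ Finset.range n, c k • (hF k).toLp : Lp ℂ p μ)
          (c n • (hF n).toLp)] with x h3 h4 h5
        rw [Finset.sum_range_succ, h5, Pi.add_apply, h3, h4, Finset.sum_range_succ]
    filter_upwards [h1] with x hx
    simp only [hx]
    exact (summable_coeff_mul hN c (a x)).hasSum.tendsto_sum_nat
  exact (memLp_congr_ae (ae_eq_of_tendsto_Lp hs.hasSum.tendsto_sum_nat hae)).1 (Lp.memLp _)

/-- If every tempered distribution with `L^p` coefficients along `a` has `L^q` coefficients along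
`b`, then an equicontinuous sequence with bounded `L^p` norms has bounded `L^q` norms. -/
theorem exists_eLpNorm_le_of_memLp_imp {X Y : Type*} [MeasurableSpace X] [MeasurableSpace Y]
    {μ : Measure X} {ν : Measure Y} {p q : ℝ≥0∞} (hp : 1 ≤ p) (hq : 1 ≤ q) (F : ℕ → 𝓢'(E, ℂ))
    (N : Finset (ℕ × ℕ)) (C : ℝ) (hC : 0 ≤ C)
    (hN : ∀ k ψ, ‖F k ψ‖ ≤ C * N.sup (schwartzSeminormFamily ℂ E ℂ) ψ)
    {V : 𝓢'(E, ℂ) → X → ℂ} {W : 𝓢'(E, ℂ) → Y → ℂ} {a : X → 𝓢(E, ℂ)} {b : Y → 𝓢(E, ℂ)}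
    (hV : ∀ f x, V f x = f (a x)) (hW : ∀ f y, W f y = f (b y))
    (hF : ∀ k, MemLp (V (F k)) p μ) (B : ℝ≥0) (hB : ∀ k, eLpNorm (V (F k)) p μ ≤ B)
    (h : ∀ f : 𝓢'(E, ℂ), MemLp (V f) p μ → MemLp (W f) q ν) :
    ∃ B' : ℝ≥0, ∀ k, eLpNorm (W (F k)) q ν ≤ B' := by
  obtain rfl : V = fun f x => f (a x) := funext fun f => funext (hV f)
  obtain rfl : W = fun f y => f (b y) := funext fun f => funext (hW f)
  have : Fact (1 ≤ p) := ⟨hp⟩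
  have : Fact (1 ≤ q) := ⟨hq⟩
  have hS : ∀ c, MemLp (fun y => superposition F N C hC hN c (b y)) q ν := fun c =>
    h _ (memLp_superposition F N C hC hN a hF B hB c)
  let T : lp (fun _ : ℕ => ℂ) 1 →ₗ[ℂ] Lp ℂ q ν :=
    { toFun := fun c => (hS c).toLp
      map_add' := fun c d => by
        rw [← MemLp.toLp_add]
        refine MemLp.toLp_congr _ _ (Eventually.of_forall fun y => ?_)
        simp only [Pi.add_apply, superposition_apply]
        rw [← (summable_coeff_mul hN c (b y)).tsum_add (summable_coeff_mul hN d (b y))]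
        simp [add_mul]
      map_smul' := fun r c => by
        rw [RingHom.id_apply, ← MemLp.toLp_const_smul]
        refine MemLp.toLp_congr _ _ (Eventually.of_forall fun y => ?_)
        simp only [Pi.smul_apply, superposition_apply, smul_eq_mul, ← tsum_mul_left]
        congr with k
        simp [mul_assoc] }
  -- Closed graph: convergence in `ℓ¹` makes the coefficient functions converge at every point,
  -- because `F k (b z)` is bounded in `k`, and this identifies any `L^q` limit.
  have hT : Continuous T := by
    refine T.continuous_of_seq_closed_graph fun u x y hu hy => ?_
    have hae : ∀ᵐ z ∂ν, Tendsto (fun n => (T ∘ u) n z) atTop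
        (𝓝 (superposition F N C hC hN x (b z))) := by
      have h1 : ∀ᵐ z ∂ν, ∀ n, (T ∘ u) n z = superposition F N C hC hN (u n) (b z) := by
        rw [ae_all_iff]
        exact fun n => (hS (u n)).coeFn_toLp
      filter_upwards [h1] with z hz
      simp only [hz]
      rw [tendsto_iff_norm_sub_tendsto_zero]
      have h2 : Tendsto (fun n => ‖u n - x‖ *
          (C * N.sup (schwartzSeminormFamily ℂ E ℂ) (b z))) atTop (𝓝 0) := by
        simpa using (tendsto_iff_norm_sub_tendsto_zero.1 hu).mul_const
          (C * N.sup (schwartzSeminormFamily ℂ E ℂ) (b z))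
      refine squeeze_zero (fun _ => norm_nonneg _) (fun n => ?_) h2
      have h3 : superposition F N C hC hN (u n) (b z) - superposition F N C hC hN x (b z)
          = ∑' k, (u n - x) k * F k (b z) := by
        simp only [superposition_apply]
        rw [← (summable_coeff_mul hN (u n) (b z)).tsum_sub (summable_coeff_mul hN x (b z))]
        simp [sub_mul]
      rw [h3]
      exact norm_tsum_coeff_mul_le hN _ _
    exact Lp.ext ((ae_eq_of_tendsto_Lp hy hae).trans (hS x).coeFn_toLp.symm)
  let T' : lp (fun _ : ℕ => ℂ) 1 →L[ℂ] Lp ℂ q ν := ⟨T, hT⟩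
  -- The unit vectors of `ℓ¹` have norm one and their superpositions are the `F k`, so the operator
  -- norm is the uniform bound.
  refine ⟨‖T'‖₊, fun k => ?_⟩
  have h1 : (fun y => superposition F N C hC hN (lp.single 1 k (1 : ℂ)) (b y))
      = fun y => F k (b y) := by
    funext y
    rw [superposition_apply, tsum_eq_single k]
    · simp
    · intro j hj
      simp [hj]
  have h2 := T'.le_opNorm (lp.single 1 k (1 : ℂ))
  rw [lp.norm_single (by simp), norm_one, mul_one] at h2
  have h3 : ‖T' (lp.single 1 k (1 : ℂ))‖ = (eLpNorm (fun y => F k (b y)) q ν).toReal := by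
    rw [← h1]
    exact Lp.norm_toLp _ (hS _)
  have h4 : eLpNorm (fun y => F k (b y)) q ν ≠ ∞ := by
    rw [← h1]
    exact (hS _).2.ne
  rw [h3] at h2
  rw [← ENNReal.ofReal_toReal h4]
  exact (ENNReal.ofReal_le_ofReal h2).trans (by simp)

end

/-! ### Products of Schwartz functions and oscillatory integrals -/

theorem norm_phaseFun (P : ℝ × ℝ → ℝ) (z : ℝ × ℝ) : ‖phaseFun P z‖ = 1 := by
  rw [phaseFun, show 2 * (Real.pi : ℂ) * Complex.I * (P z : ℂ)
    = ((2 * Real.pi * P z : ℝ) : ℂ) * Complex.I by push_cast; ring]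
  exact Complex.norm_exp_ofReal_mul_I _

theorem phaseFun_mul (P Q : ℝ × ℝ → ℝ) (z : ℝ × ℝ) :
    phaseFun P z * phaseFun Q z = phaseFun (fun z => P z + Q z) z := by
  simp only [phaseFun, ← Complex.exp_add]
  push_cast
  ring_nf

theorem conj_phaseFun (P : ℝ × ℝ → ℝ) (z : ℝ × ℝ) :
    (starRingEnd ℂ) (phaseFun P z) = phaseFun (fun z => -P z) z := by
  simp only [phaseFun, ← Complex.exp_conj]
  simp [map_ofNat]

theorem continuous_phaseFun {P : ℝ × ℝ → ℝ} (hP : Continuous P) : Continuous (phaseFun P) := by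
  unfold phaseFun
  fun_prop

theorem hasLineDerivAt_phaseFun {P : ℝ × ℝ → ℝ} {d : ℝ} {z v : ℝ × ℝ}
    (hP : HasLineDerivAt ℝ P d z v) :
    HasLineDerivAt ℝ (phaseFun P) (2 * (Real.pi : ℂ) * Complex.I * d * phaseFun P z) z v := by
  unfold HasLineDerivAt at hP ⊢
  have h := ((hP.ofReal_comp).const_mul (2 * (Real.pi : ℂ) * Complex.I)).cexp
  simp only [zero_smul, add_zero] at h
  refine h.congr_deriv ?_
  rw [phaseFun]
  ring

/-- The pointwise product of two Schwartz functions. -/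
def schwartzMul (G H : 𝓢(ℝ × ℝ, ℂ)) : 𝓢(ℝ × ℝ, ℂ) :=
  SchwartzMap.pairing (ContinuousLinearMap.mul ℂ ℂ) G H

theorem schwartzMul_apply (G H : 𝓢(ℝ × ℝ, ℂ)) (z : ℝ × ℝ) : schwartzMul G H z = G z * H z := rfl

theorem hasLineDerivAt_schwartz (G : 𝓢(ℝ × ℝ, ℂ)) (z v : ℝ × ℝ) :
    HasLineDerivAt ℝ G (∂_{v} G z) z v := by
  rw [SchwartzMap.lineDerivOp_apply]
  exact (G.hasFDerivAt z).differentiableAt.lineDifferentiableAt.hasLineDerivAt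

theorem lineDerivOp_schwartzMul (G H : 𝓢(ℝ × ℝ, ℂ)) (v : ℝ × ℝ) :
    ∂_{v} (schwartzMul G H) = schwartzMul (∂_{v} G) H + schwartzMul G (∂_{v} H) := by
  ext z
  have h : HasLineDerivAt ℝ (schwartzMul G H) (∂_{v} G z * H z + G z * ∂_{v} H z) z v := by
    have h1 := hasLineDerivAt_schwartz G z v
    have h2 := hasLineDerivAt_schwartz H z v
    unfold HasLineDerivAt at h1 h2 ⊢
    have h3 := h1.mul h2
    simp only [zero_smul, add_zero] at h3
    exact h3
  rw [SchwartzMap.lineDerivOp_apply, h.lineDeriv]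
  rfl

theorem lineDerivOp_schwartzConj (g : 𝓢(ℝ × ℝ, ℂ)) (v : ℝ × ℝ) :
    ∂_{v} (schwartzConj g) = schwartzConj (∂_{v} g) := by
  ext z
  have h : HasLineDerivAt ℝ (schwartzConj g) ((starRingEnd ℂ) (∂_{v} g z)) z v := by
    have h1 := hasLineDerivAt_schwartz g z v
    unfold HasLineDerivAt at h1 ⊢
    exact (Complex.conjCLE : ℂ →L[ℝ] ℂ).hasFDerivAt.comp_hasDerivAt _ h1
  rw [SchwartzMap.lineDerivOp_apply, h.lineDeriv]
  rfl

theorem transl_apply (y : ℝ × ℝ) (g : 𝓢(ℝ × ℝ, ℂ)) (z : ℝ × ℝ) : transl y g z = g (z - y) := rfl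

theorem lineDerivOp_transl (g : 𝓢(ℝ × ℝ, ℂ)) (v y : ℝ × ℝ) :
    ∂_{v} (transl y g) = transl y (∂_{v} g) := by
  ext z
  have h : HasLineDerivAt ℝ (transl y g) (∂_{v} g (z - y)) z v := by
    have h1 := hasLineDerivAt_schwartz g (z - y) v
    unfold HasLineDerivAt at h1 ⊢
    simp only [transl_apply]
    convert! h1 using 3 with t
    abel
  rw [SchwartzMap.lineDerivOp_apply, h.lineDeriv]
  rfl

/-- The windowed function `z ↦ G(z) conj(g(z - y))`. -/
def winProd (G g : 𝓢(ℝ × ℝ, ℂ)) (y : ℝ × ℝ) : 𝓢(ℝ × ℝ, ℂ) :=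
  schwartzMul G (schwartzConj (transl y g))

theorem winProd_apply (G g : 𝓢(ℝ × ℝ, ℂ)) (y z : ℝ × ℝ) :
    winProd G g y z = G z * (starRingEnd ℂ) (g (z - y)) := rfl

theorem lineDerivOp_winProd (G g : 𝓢(ℝ × ℝ, ℂ)) (v y : ℝ × ℝ) :
    ∂_{v} (winProd G g y) = winProd (∂_{v} G) g y + winProd G (∂_{v} g) y := by
  rw [winProd, lineDerivOp_schwartzMul, lineDerivOp_schwartzConj, lineDerivOp_transl]
  rfl

theorem norm_schwartz_le (g : 𝓢(ℝ × ℝ, ℂ)) (z : ℝ × ℝ) :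
    ‖g z‖ ≤ SchwartzMap.seminorm ℂ 0 0 g := g.norm_le_seminorm ℂ z

theorem norm_winProd_le (G g : 𝓢(ℝ × ℝ, ℂ)) (y z : ℝ × ℝ) :
    ‖winProd G g y z‖ ≤ ‖G z‖ * SchwartzMap.seminorm ℂ 0 0 g := by
  rw [winProd_apply, norm_mul, RCLike.norm_conj]
  gcongr
  exact norm_schwartz_le g _

theorem integral_norm_winProd_le (G g : 𝓢(ℝ × ℝ, ℂ)) (y : ℝ × ℝ) :
    ∫ z, ‖winProd G g y z‖ ≤ (∫ z, ‖G z‖) * SchwartzMap.seminorm ℂ 0 0 g := by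
  rw [← integral_mul_const]
  exact integral_mono (winProd G g y).integrable.norm (G.integrable.norm.mul_const _)
    fun z => norm_winProd_le G g y z

/-- Leibniz rule, with the window factor replaced by its supremum. The point is that the bound does
not depend on the translation `y`, hence is uniform over the group. -/
theorem integral_norm_lineDerivOp_winProd_le (G g : 𝓢(ℝ × ℝ, ℂ)) (v y : ℝ × ℝ) :
    ∫ z, ‖∂_{v} (winProd G g y) z‖ ≤ (∫ z, ‖∂_{v} G z‖) * SchwartzMap.seminorm ℂ 0 0 g
      + (∫ z, ‖G z‖) * SchwartzMap.seminorm ℂ 0 0 (∂_{v} g) := by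
  refine le_trans ?_ (add_le_add (integral_norm_winProd_le (∂_{v} G) g y)
    (integral_norm_winProd_le G (∂_{v} g) y))
  rw [lineDerivOp_winProd, ← integral_add (winProd (∂_{v} G) g y).integrable.norm
    (winProd G (∂_{v} g) y).integrable.norm]
  refine integral_mono (SchwartzMap.integrable _).norm ((winProd (∂_{v} G) g y).integrable.norm.add
    (winProd G (∂_{v} g) y).integrable.norm) fun z => ?_
  exact norm_add_le _ _

/-- Decay in the first variable alone suffices for the chirp estimate: integrability in the second
variable will come from the chirp. -/
theorem exists_norm_le_div_one_add_sq (G : 𝓢(ℝ × ℝ, ℂ)) :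
    ∃ M, 0 ≤ M ∧ ∀ z, ‖G z‖ ≤ M * (1 + z.1 ^ 2)⁻¹ := by
  refine ⟨SchwartzMap.seminorm ℂ 0 0 G + SchwartzMap.seminorm ℂ 2 0 G, by positivity, fun z => ?_⟩
  rw [← div_eq_mul_inv, le_div_iff₀ (by positivity), mul_add, mul_one]
  refine add_le_add (norm_schwartz_le G z) ?_
  have h1 := G.norm_pow_mul_le_seminorm ℂ 2 z
  have h2 : z.1 ^ 2 ≤ ‖z‖ ^ 2 := by
    rw [← sq_abs z.1]
    exact pow_le_pow_left₀ (abs_nonneg _) (norm_fst_le z) 2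
  nlinarith [norm_nonneg (G z)]

theorem integrable_mul_bounded (U : 𝓢(ℝ × ℝ, ℂ)) {K : ℝ × ℝ → ℂ} (hK : Continuous K) {B : ℝ}
    (hB : ∀ z, ‖K z‖ ≤ B) : Integrable fun z => U z * K z :=
  U.integrable.mul_bdd (c := B) hK.aestronglyMeasurable (Eventually.of_forall hB)

/-- Integration by parts against a bounded multiplier. -/
theorem integral_schwartz_mul_lineDeriv (U : 𝓢(ℝ × ℝ, ℂ)) {K K' : ℝ × ℝ → ℂ} {v : ℝ × ℝ}
    (hK : Continuous K) (hK' : Continuous K') {B B' : ℝ} (hB : ∀ z, ‖K z‖ ≤ B)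
    (hB' : ∀ z, ‖K' z‖ ≤ B') (h : ∀ z, HasLineDerivAt ℝ K (K' z) z v) :
    ∫ z, U z * K' z = -∫ z, ∂_{v} U z * K z :=
  integral_bilinear_hasLineDerivAt_right_eq_neg_left_of_integrable
    (B := ContinuousLinearMap.mul ℝ ℂ) (integrable_mul_bounded (∂_{v} U) hK hB)
    (integrable_mul_bounded U hK' hB') (integrable_mul_bounded U hK hB)
    (fun z _ => hasLineDerivAt_schwartz U z v) (fun z _ => h z)

theorem norm_integral_mul_phaseFun_le (U : 𝓢(ℝ × ℝ, ℂ)) (P : ℝ × ℝ → ℝ) :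
    ‖∫ z, U z * phaseFun P z‖ ≤ ∫ z, ‖U z‖ := by
  refine (norm_integral_le_integral_norm _).trans_eq ?_
  simp [norm_phaseFun]

/-- Integration by parts against a phase with constant derivative in the direction `v`. -/
theorem mul_integral_mul_phaseFun (U : 𝓢(ℝ × ℝ, ℂ)) {P : ℝ × ℝ → ℝ} {d : ℝ} {v : ℝ × ℝ}
    (hP : Continuous P) (h : ∀ z, HasLineDerivAt ℝ P d z v) :
    2 * (Real.pi : ℂ) * Complex.I * d * ∫ z, U z * phaseFun P z
      = -∫ z, ∂_{v} U z * phaseFun P z := by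
  rw [← integral_schwartz_mul_lineDeriv U (continuous_phaseFun hP)
    (K' := fun z => 2 * (Real.pi : ℂ) * Complex.I * d * phaseFun P z)
    (continuous_const.mul (continuous_phaseFun hP)) (fun z => (norm_phaseFun P z).le)
    (B' := ‖2 * (Real.pi : ℂ) * Complex.I * d‖)
    (fun z => by rw [norm_mul, norm_phaseFun, mul_one]) (fun z => hasLineDerivAt_phaseFun (h z)),
    ← integral_const_mul]
  congr with z
  ring

/-- The nonstationary estimate: one integration by parts gains the factor `1/|d|`. The constant `2π
≥ 1` is discarded. -/
theorem abs_mul_norm_integral_mul_phaseFun_le (U : 𝓢(ℝ × ℝ, ℂ)) {P : ℝ × ℝ → ℝ} {d : ℝ}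
    {v : ℝ × ℝ} (hP : Continuous P) (h : ∀ z, HasLineDerivAt ℝ P d z v) :
    |d| * ‖∫ z, U z * phaseFun P z‖ ≤ ∫ z, ‖∂_{v} U z‖ := by
  have h1 := congrArg norm (mul_integral_mul_phaseFun U hP h)
  rw [norm_neg, norm_mul] at h1
  have h2 : ‖2 * (Real.pi : ℂ) * Complex.I * d‖ = 2 * Real.pi * |d| := by
    simp [abs_of_pos Real.pi_pos]
  rw [h2] at h1
  have h3 := norm_integral_mul_phaseFun_le (∂_{v} U) P
  have h4 : 0 ≤ |d| * ‖∫ z, U z * phaseFun P z‖ := by positivity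
  nlinarith [Real.pi_gt_three]

theorem integrable_inv_one_add_mul_sq {a : ℝ} (ha : 0 < a) (c : ℝ) :
    Integrable fun t : ℝ => (1 + a * (t - c) ^ 2)⁻¹ := by
  have h := (integrable_inv_one_add_sq.comp_mul_left' (Real.sqrt_pos.2 ha).ne').comp_sub_right c
  simpa [mul_pow, Real.sq_sqrt ha.le] using h

theorem integral_inv_one_add_mul_sq {a : ℝ} (ha : 0 < a) (c : ℝ) :
    ∫ t : ℝ, (1 + a * (t - c) ^ 2)⁻¹ = Real.pi / √a := by
  rw [integral_sub_right_eq_self (fun t : ℝ => (1 + a * t ^ 2)⁻¹) c]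
  have h := Measure.integral_comp_mul_left (fun t : ℝ => (1 + t ^ 2)⁻¹) (√a)
  simp only [mul_pow, Real.sq_sqrt ha.le, integral_univ_inv_one_add_sq] at h
  rw [h, abs_of_pos (by positivity), smul_eq_mul]
  field_simp

/-! ### Oscillatory integrals with a quadratic phase -/

section chirp

/-- The denominator `1 - 2πi a τ²` of the integration by parts against a chirp. -/
def chirpDenom (a τ : ℝ) : ℂ := 1 - 2 * (Real.pi : ℂ) * Complex.I * a * τ ^ 2

theorem norm_sq_chirpDenom (a τ : ℝ) : ‖chirpDenom a τ‖ ^ 2 = 1 + (2 * Real.pi * a * τ ^ 2) ^ 2 := by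
  have h : chirpDenom a τ = ⟨1, -(2 * Real.pi * a * τ ^ 2)⟩ := by
    apply Complex.ext <;> simp [chirpDenom, ← Complex.ofReal_pow]
  rw [h, Complex.sq_norm, Complex.normSq_mk]
  ring

theorem chirpDenom_ne_zero (a τ : ℝ) : chirpDenom a τ ≠ 0 := by
  intro h
  have := norm_sq_chirpDenom a τ
  rw [h] at this
  norm_num at this
  nlinarith [sq_nonneg (2 * Real.pi * a * τ ^ 2)]

theorem continuous_chirpDenom (a : ℝ) : Continuous (chirpDenom a) := by
  unfold chirpDenom
  fun_prop

/-- With `u = 2πaτ²` the squared modulus of the denominator is `1 + u² ≥ 2u ≥ aτ²`. -/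
theorem norm_div_chirpDenom_le {a : ℝ} (ha : 0 < a) (τ : ℝ) :
    ‖(τ : ℂ) / chirpDenom a τ‖ ≤ 1 / √a := by
  have hD : 0 < ‖chirpDenom a τ‖ := norm_pos_iff.2 (chirpDenom_ne_zero a τ)
  rw [norm_div, div_le_div_iff₀ hD (by positivity), one_mul]
  refine le_of_sq_le_sq ?_ hD.le
  rw [mul_pow, norm_sq_chirpDenom, Real.sq_sqrt ha.le, Complex.norm_real, Real.norm_eq_abs, sq_abs]
  have h1 : 0 ≤ a * τ ^ 2 := by positivity
  have h2 := Real.pi_gt_three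
  nlinarith [sq_nonneg (2 * Real.pi * a * τ ^ 2 - 1)]

/-- With `u = 2πaτ²` the left side is `2u / (1 + u²)`, and `aτ² ≤ u`. This error term is integrable
in `τ` with integral of order `a^{-1/2}`. -/
theorem norm_mul_div_chirpDenom_sq_le {a : ℝ} (ha : 0 < a) (τ : ℝ) :
    ‖4 * (Real.pi : ℂ) * Complex.I * a * τ ^ 2 / chirpDenom a τ ^ 2‖
      ≤ 4 * (1 + a * τ ^ 2)⁻¹ := by
  rw [norm_div, norm_pow (chirpDenom a τ), norm_sq_chirpDenom, ← div_eq_mul_inv,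
    div_le_div_iff₀ (by positivity) (by positivity)]
  have h0 : ‖4 * (Real.pi : ℂ) * Complex.I * a * τ ^ 2‖ = 2 * (2 * Real.pi * a * τ ^ 2) := by
    simp [abs_of_pos Real.pi_pos, abs_of_pos ha]
    ring
  rw [h0]
  have h1 : 0 ≤ a * τ ^ 2 := by positivity
  have h2 := Real.pi_gt_three
  have h3 : a * τ ^ 2 ≤ 2 * Real.pi * a * τ ^ 2 := by nlinarith
  nlinarith [sq_nonneg (2 * Real.pi * a * τ ^ 2 - 1)]

/-- The derivative of the multiplier used to integrate by parts against a chirp. -/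
theorem hasLineDerivAt_chirp {P : ℝ × ℝ → ℝ} {a c : ℝ} {z : ℝ × ℝ}
    (hP : HasLineDerivAt ℝ P (-a * (z.2 - c)) z (0, 1)) :
    HasLineDerivAt ℝ (fun z => ((z.2 - c : ℝ) : ℂ) / chirpDenom a (z.2 - c) * phaseFun P z)
      (phaseFun P z + 4 * (Real.pi : ℂ) * Complex.I * a * (z.2 - c : ℝ) ^ 2 /
        chirpDenom a (z.2 - c) ^ 2 * phaseFun P z) z (0, 1) := by
  have h1 := hasLineDerivAt_phaseFun hP
  unfold HasLineDerivAt at h1 ⊢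
  have h2 : HasDerivAt (fun t : ℝ => (((z + t • ((0, 1) : ℝ × ℝ)).2 - c : ℝ) : ℂ)) 1 0 := by
    have : HasDerivAt (fun t : ℝ => (z + t • ((0, 1) : ℝ × ℝ)).2 - c) 1 0 := by
      simpa using ((hasDerivAt_id (0 : ℝ)).const_add z.2).sub_const c
    simpa using this.ofReal_comp
  have h3 : HasDerivAt (fun t : ℝ => chirpDenom a ((z + t • ((0, 1) : ℝ × ℝ)).2 - c))
      (-(2 * (Real.pi : ℂ) * Complex.I * a * (2 * ((z.2 - c : ℝ) : ℂ)))) 0 := by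
    have := ((h2.pow 2).const_mul (2 * (Real.pi : ℂ) * Complex.I * a)).const_sub 1
    refine this.congr_deriv ?_
    simp
  have h4 := (h2.div h3 (chirpDenom_ne_zero a _)).mul h1
  refine h4.congr_deriv ?_
  have hD := chirpDenom_ne_zero a (z.2 - c)
  simp only [Pi.div_apply, zero_smul, add_zero, one_mul]
  have hD' : chirpDenom a (z.2 - c)
    = 1 - 2 * (Real.pi : ℂ) * Complex.I * a * ((z.2 - c : ℝ) : ℂ) ^ 2 := rfl
  field_simp
  rw [hD']
  push_cast
  ring

/-- Decay of an oscillatory integral whose phase is a chirp of rate `a` in the second variable. -/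
theorem norm_integral_mul_chirp_le (U : 𝓢(ℝ × ℝ, ℂ)) {P : ℝ × ℝ → ℝ} {a c M : ℝ} (ha : 0 < a)
    (hP : Continuous P) (h : ∀ z, HasLineDerivAt ℝ P (-a * (z.2 - c)) z (0, 1))
    (hM : 0 ≤ M) (hU : ∀ z, ‖U z‖ ≤ M * (1 + z.1 ^ 2)⁻¹) :
    ‖∫ z, U z * phaseFun P z‖
      ≤ ((∫ z, ‖∂_{((0, 1) : ℝ × ℝ)} U z‖) + 4 * Real.pi ^ 2 * M) / √a := by
  have hD : Continuous fun z : ℝ × ℝ => chirpDenom a (z.2 - c) :=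
    (continuous_chirpDenom a).comp (by fun_prop)
  have hph := continuous_phaseFun hP
  -- With `τ = z.2 - c` and `D = 1 - 2πiaτ²`, the phase factor `e` satisfies `(1 + τ∂_t)e = De`.
  -- Hence `∂_t(τe/D) = e + R`. Unlike division by the phase derivative, the multiplier `τ/D` stays
  -- regular at the stationary point `τ = 0`.
  set K : ℝ × ℝ → ℂ := fun z => ((z.2 - c : ℝ) : ℂ) / chirpDenom a (z.2 - c) * phaseFun P z with hKd
  set R : ℝ × ℝ → ℂ := fun z => 4 * (Real.pi : ℂ) * Complex.I * a * (z.2 - c : ℝ) ^ 2 /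
        chirpDenom a (z.2 - c) ^ 2 * phaseFun P z with hRd
  have hK : Continuous K :=
    (Continuous.div (by fun_prop) hD fun z => chirpDenom_ne_zero _ _).mul hph
  have hR : Continuous R :=
    (Continuous.div (by fun_prop) (hD.pow 2) fun z => pow_ne_zero 2 (chirpDenom_ne_zero _ _)).mul
      hph
  have hKb : ∀ z, ‖K z‖ ≤ 1 / √a := fun z => by
    rw [hKd, norm_mul, norm_phaseFun, mul_one]
    exact norm_div_chirpDenom_le ha _
  have hRb : ∀ z, ‖R z‖ ≤ 4 * (1 + a * (z.2 - c) ^ 2)⁻¹ := fun z => by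
    rw [hRd, norm_mul, norm_phaseFun, mul_one]
    exact norm_mul_div_chirpDenom_sq_le ha _
  have hRb' : ∀ z, ‖R z‖ ≤ 4 := fun z => by
    refine (hRb z).trans ?_
    have : (1 + a * (z.2 - c) ^ 2)⁻¹ ≤ 1 := inv_le_one_of_one_le₀ (by nlinarith [sq_nonneg (z.2 - c)])
    linarith
  have hibp := integral_schwartz_mul_lineDeriv U hK (K' := fun z => phaseFun P z + R z)
    (hph.add hR) hKb (B' := 1 + 4)
    (fun z => (norm_add_le _ _).trans (add_le_add (norm_phaseFun P z).le (hRb' z)))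
    (fun z => hasLineDerivAt_chirp (h z))
  have hsplit : ∫ z, U z * (phaseFun P z + R z)
      = (∫ z, U z * phaseFun P z) + ∫ z, U z * R z := by
    rw [← integral_add (integrable_mul_bounded U hph fun z => (norm_phaseFun P z).le)
      (integrable_mul_bounded U hR hRb')]
    simp [mul_add]
  rw [hsplit] at hibp
  rw [eq_sub_of_add_eq hibp]
  refine (norm_sub_le _ _).trans ?_
  rw [norm_neg, add_div]
  refine add_le_add ?_ ?_
  · refine (norm_integral_le_integral_norm _).trans ?_
    rw [← integral_div]
    refine integral_mono (integrable_mul_bounded _ hK hKb).norm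
      ((SchwartzMap.integrable _).norm.div_const _) fun z => ?_
    simp only [norm_mul]
    rw [div_eq_mul_one_div]
    gcongr
    exact hKb z
  -- The majorant of `U R` is a product: the integral in `s` gives `πM`, the one in `t` gives
  -- `4π/√a`, whence `4π²M/√a`.
  · have hi : Integrable fun z : ℝ × ℝ => (M * (1 + z.1 ^ 2)⁻¹) * (4 * (1 + a * (z.2 - c) ^ 2)⁻¹) :=
      (integrable_inv_one_add_sq.const_mul M).mul_prod
        ((integrable_inv_one_add_mul_sq ha c).const_mul 4)
    refine (norm_integral_le_integral_norm _).trans ((integral_mono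
      (integrable_mul_bounded _ hR hRb').norm hi fun z => ?_).trans_eq ?_)
    · simp only [norm_mul]
      have := hU z
      gcongr
      exact hRb z
    · rw [Measure.volume_eq_prod, integral_prod_mul (fun s : ℝ => M * (1 + s ^ 2)⁻¹)
        (fun t : ℝ => 4 * (1 + a * (t - c) ^ 2)⁻¹), integral_const_mul, integral_const_mul,
        integral_univ_inv_one_add_sq, integral_inv_one_add_mul_sq ha]
      ring

end chirp

/-! ### Transforms of Schwartz functions as oscillatory integrals -/

/-- A Schwartz function as a tempered distribution. -/
def schwartzDist (G : 𝓢(ℝ × ℝ, ℂ)) : 𝓢'(ℝ × ℝ, ℂ) :=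
  SchwartzMap.toTemperedDistributionCLM (ℝ × ℝ) ℂ volume G

theorem schwartzDist_apply (G ψ : 𝓢(ℝ × ℝ, ℂ)) : schwartzDist G ψ = ∫ z, ψ z * G z :=
  SchwartzMap.toTemperedDistributionCLM_apply_apply volume G ψ

theorem modul_eq (ξ : ℝ × ℝ) (G : 𝓢(ℝ × ℝ, ℂ)) (z : ℝ × ℝ) :
    modul ξ G z = phaseFun (fun z => ξ.1 * z.1 + ξ.2 * z.2) z * G z := modul_apply ξ G z

theorem winProd_modul (ξ : ℝ × ℝ) (G g : 𝓢(ℝ × ℝ, ℂ)) (y z : ℝ × ℝ) :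
    winProd (modul ξ G) g y z
      = winProd G g y z * phaseFun (fun z => ξ.1 * z.1 + ξ.2 * z.2) z := by
  rw [winProd_apply, winProd_apply, modul_eq]
  ring

theorem stft_schwartzDist (γ G : 𝓢(ℝ × ℝ, ℂ)) (w : (ℝ × ℝ) × (ℝ × ℝ)) :
    stft γ (schwartzDist G) w
      = ∫ z, winProd G γ w.1 z * phaseFun (fun z => -(w.2.1 * z.1 + w.2.2 * z.2)) z := by
  rw [stft, sesqPairing, schwartzDist_apply]
  congr with z
  rw [schwartzConj_apply, modul_eq, map_mul, conj_phaseFun, winProd_apply, transl_apply]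
  ring

theorem stft_schwartzDist_modul (γ G : 𝓢(ℝ × ℝ, ℂ)) (η : ℝ × ℝ) (w : (ℝ × ℝ) × (ℝ × ℝ)) :
    stft γ (schwartzDist (modul η G)) w = stft γ (schwartzDist G) (w.1, w.2 - η) := by
  rw [stft_schwartzDist, stft_schwartzDist]
  congr with z
  rw [winProd_modul, mul_assoc, phaseFun_mul]
  congr 2
  funext z
  simp only [Prod.fst_sub, Prod.snd_sub]
  ring

theorem coeff_schwartzDist (l : ℝ) (g G : 𝓢(ℝ × ℝ, ℂ)) (x : G53) :
    G53.coeff l g (schwartzDist G) x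
      = ∫ z, winProd G g (x.x3, x.x5) z * phaseFun (fun z => -G53.repPhase l x z) z := by
  rw [G53.coeff, sesqPairing, schwartzDist_apply]
  congr with z
  have h : G53.rep l x g z = phaseFun (G53.repPhase l x) z * g (z - (x.x3, x.x5)) :=
    G53.repOp_apply l x g z.1 z.2
  rw [schwartzConj_apply, h, map_mul, conj_phaseFun, winProd_apply]
  ring

theorem coeff_schwartzDist_modul (l : ℝ) (g G : 𝓢(ℝ × ℝ, ℂ)) (k : ℝ) (x : G53) :
    G53.coeff l g (schwartzDist (modul (k, 0) G)) x
      = ∫ z, winProd G g (x.x3, x.x5) z *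
          phaseFun (fun z => k * z.1 - G53.repPhase l x z) z := by
  rw [coeff_schwartzDist]
  congr with z
  rw [winProd_modul, mul_assoc, phaseFun_mul]
  congr 2
  funext z
  ring

theorem continuous_integral_winProd {W : Type*} [TopologicalSpace W] [FirstCountableTopology W]
    (G g : 𝓢(ℝ × ℝ, ℂ)) {y : W → ℝ × ℝ} (hy : Continuous y) {P : W → ℝ × ℝ → ℝ}
    (hP : Continuous fun v : W × (ℝ × ℝ) => P v.1 v.2) :
    Continuous fun w => ∫ z, winProd G g (y w) z * phaseFun (P w) z := by
  refine continuous_of_dominated (bound := fun z => ‖G z‖ * SchwartzMap.seminorm ℂ 0 0 g)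
    (fun w => ?_) (fun w => ?_) (G.integrable.norm.mul_const _) (Eventually.of_forall fun z => ?_)
  · have : Continuous (P w) := hP.comp (by fun_prop : Continuous fun z => (w, z))
    exact ((winProd G g (y w)).continuous.mul (continuous_phaseFun this)).aestronglyMeasurable
  · refine Eventually.of_forall fun z => ?_
    rw [norm_mul, norm_phaseFun, mul_one]
    exact norm_winProd_le _ _ _ _
  · have h1 : Continuous fun w => P w z := hP.comp (by fun_prop : Continuous fun w => (w, z))
    have h2 : Continuous fun w => g (z - y w) := g.continuous.comp (by fun_prop)
    simp only [winProd_apply, phaseFun]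
    exact (continuous_const.mul (Complex.continuous_conj.comp h2)).mul (by fun_prop)

theorem continuous_stft_schwartzDist (γ G : 𝓢(ℝ × ℝ, ℂ)) :
    Continuous (stft γ (schwartzDist G)) := by
  simp only [funext (stft_schwartzDist γ G)]
  exact continuous_integral_winProd G γ continuous_fst (by fun_prop)

theorem continuous_coeff_schwartzDist (l : ℝ) (g G : 𝓢(ℝ × ℝ, ℂ)) :
    Continuous fun w => G53.coeff l g (schwartzDist G) (G53.sec w) := by
  simp only [coeff_schwartzDist]
  refine continuous_integral_winProd G g (y := fun w : ℝ × ℝ × ℝ × ℝ => (w.2.1, w.2.2.2))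
    (by fun_prop) ?_
  simp only [G53.repPhase, G53.sec]
  fun_prop

/-! ### Uniform decay -/

theorem lineDeriv_fst_phase (l k : ℝ) (x : G53) (z : ℝ × ℝ) :
    HasLineDerivAt ℝ (fun z => k * z.1 - G53.repPhase l x z) (k - l * x.x4) z (1, 0) := by
  unfold HasLineDerivAt G53.repPhase
  have h : HasDerivAt (fun t : ℝ => z.1 + t) 1 0 := by
    simpa using (hasDerivAt_id (0 : ℝ)).const_add z.1
  have h1 := (h.const_mul (k - l * x.x4)).sub_const
    (l * (x.x1 - x.x3 * x.x4 - x.x2 * z.2 + 1 / 2 * x.x4 * z.2 ^ 2))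
  convert! h1 using 1
  · funext t
    simp
    ring
  · ring

/-- In `t` the phase is quadratic; completing the square puts its stationary point at `x₂/x₄`. It is
a chirp of rate `λx₄`, whatever `k` is. -/
theorem lineDeriv_snd_phase (l k : ℝ) (x : G53) (hx : x.x4 ≠ 0) (z : ℝ × ℝ) :
    HasLineDerivAt ℝ (fun z => k * z.1 - G53.repPhase l x z)
      (-(l * x.x4) * (z.2 - x.x2 / x.x4)) z (0, 1) := by
  unfold HasLineDerivAt G53.repPhase
  have h : HasDerivAt (fun t : ℝ => z.2 + t) 1 0 := by
    simpa using (hasDerivAt_id (0 : ℝ)).const_add z.2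
  have h1 := (((h.const_mul (l * x.x2)).sub ((h.pow 2).const_mul (l * x.x4 / 2)))).add_const
    (k * z.1 - l * (x.x1 - x.x3 * x.x4 + x.x4 * z.1))
  convert! h1 using 1
  · funext t
    simp
    ring
  · field_simp
    simp
    ring

/-- The coefficients of a modulated Schwartz function decay uniformly in the modulation. -/
theorem exists_norm_coeff_modul_le (l : ℝ) (g G : 𝓢(ℝ × ℝ, ℂ)) :
    ∃ C, 0 ≤ C ∧ ∀ k : ℝ, 1 ≤ k → ∀ x,
      ‖G53.coeff l g (schwartzDist (modul (k, 0) G)) x‖ ≤ C / √k := by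
  obtain ⟨M, hM, hG⟩ := exists_norm_le_div_one_add_sq G
  set A : ℝ × ℝ → ℝ := fun v => (∫ z, ‖∂_{v} G z‖) * SchwartzMap.seminorm ℂ 0 0 g
      + (∫ z, ‖G z‖) * SchwartzMap.seminorm ℂ 0 0 (∂_{v} g) with hA
  have hA0 : ∀ v, 0 ≤ A v := fun v => by positivity
  set M' := M * SchwartzMap.seminorm ℂ 0 0 g with hM'
  have hM0 : 0 ≤ M' := by positivity
  have hA1 := hA0 (1, 0)
  have hA2 := hA0 (0, 1)
  refine ⟨2 * A (1, 0) + 2 * (A (0, 1) + 4 * Real.pi ^ 2 * M'), by positivity,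
    fun k hk x => ?_⟩
  rw [coeff_schwartzDist_modul]
  set U := winProd G g (x.x3, x.x5) with hU
  have hk0 : 0 < k := by linarith
  have hPc : Continuous fun z => k * z.1 - G53.repPhase l x z := by
    unfold G53.repPhase
    fun_prop
  rw [add_div]
  -- If the `s`-derivative of the phase is at least `k/2` in modulus, integration by parts in `s`
  -- gives `O(1/k)`. Otherwise `λx₄ > k/2`, and the chirp in `t` gives `O(k^{-1/2})`.
  by_cases h : k / 2 ≤ |k - l * x.x4|
  · have h1 := (abs_mul_norm_integral_mul_phaseFun_le U hPc (lineDeriv_fst_phase l k x)).trans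
      (integral_norm_lineDerivOp_winProd_le G g (1, 0) (x.x3, x.x5))
    have h2 : k / 2 * ‖∫ z, U z * phaseFun (fun z => k * z.1 - G53.repPhase l x z) z‖ ≤ A (1, 0) :=
      le_trans (by gcongr) h1
    have h3 : √k ≤ k := Real.sqrt_le_iff.2 ⟨hk0.le, by nlinarith⟩
    have h4 : 0 ≤ 2 * (A (0, 1) + 4 * Real.pi ^ 2 * M') / √k := by
      have := hA0 (0, 1)
      positivity
    refine le_add_of_le_of_nonneg ?_ h4
    rw [le_div_iff₀ (by positivity)]
    nlinarith [norm_nonneg (∫ z, U z * phaseFun (fun z => k * z.1 - G53.repPhase l x z) z)]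
  · push Not at h
    have ha : k / 2 < l * x.x4 := by
      have := (abs_lt.1 h).2
      linarith
    have ha0 : 0 < l * x.x4 := by linarith
    have hx : x.x4 ≠ 0 := by
      rintro h0
      simp [h0] at ha0
    have h1 := norm_integral_mul_chirp_le U ha0 hPc (lineDeriv_snd_phase l k x hx) hM0
      (fun z => by
        refine (norm_winProd_le G g _ z).trans ?_
        rw [hM', mul_right_comm]
        gcongr
        exact hG z)
    have h2 := integral_norm_lineDerivOp_winProd_le G g (0, 1) (x.x3, x.x5)
    have h3 : √k ≤ 2 * √(l * x.x4) := by
      rw [show (2 : ℝ) = √4 by rw [show (4 : ℝ) = 2 ^ 2 by norm_num]; simp,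
        ← Real.sqrt_mul (by norm_num)]
      exact Real.sqrt_le_sqrt (by linarith)
    have h5 : 0 ≤ 2 * A (1, 0) / √k := by
      have := hA0 (1, 0)
      positivity
    refine le_add_of_nonneg_of_le h5 (h1.trans ?_)
    have h6 : 0 ≤ A (0, 1) + 4 * Real.pi ^ 2 * M' := by have := hA0 (0, 1); positivity
    calc _ ≤ (A (0, 1) + 4 * Real.pi ^ 2 * M') / √(l * x.x4) := by gcongr
      _ ≤ _ := by
        rw [div_le_div_iff₀ (by positivity) (by positivity)]
        nlinarith

/-- Modulated Schwartz functions tend to zero as tempered distributions, at a uniform rate. -/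
theorem exists_norm_schwartzDist_modul_le (G : 𝓢(ℝ × ℝ, ℂ)) :
    ∃ C, 0 ≤ C ∧ ∀ k : ℝ, 0 < k → ∀ ψ, k * ‖schwartzDist (modul (k, 0) G) ψ‖
      ≤ C * (({(0, 0), (0, 1)} : Finset (ℕ × ℕ)).sup
          (schwartzSeminormFamily ℂ (ℝ × ℝ) ℂ)) ψ := by
  refine ⟨(∫ z, ‖∂_{((1, 0) : ℝ × ℝ)} G z‖) + ∫ z, ‖G z‖, by positivity, fun k hk ψ => ?_⟩
  have h1 : schwartzDist (modul (k, 0) G) ψ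
      = ∫ z, schwartzMul G ψ z * phaseFun (fun z => k * z.1) z := by
    rw [schwartzDist_apply]
    congr with z
    rw [modul_eq, schwartzMul_apply]
    simp only [zero_mul, add_zero]
    ring
  have h2 : ∀ z, HasLineDerivAt ℝ (fun z : ℝ × ℝ => k * z.1) k z (1, 0) := fun z => by
    unfold HasLineDerivAt
    simpa using ((hasDerivAt_id (0 : ℝ)).const_add z.1).const_mul k
  have h3 := abs_mul_norm_integral_mul_phaseFun_le (schwartzMul G ψ) (by fun_prop) h2
  rw [abs_of_pos hk] at h3
  rw [h1]
  refine h3.trans ?_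
  set S := ({(0, 0), (0, 1)} : Finset (ℕ × ℕ)).sup (schwartzSeminormFamily ℂ (ℝ × ℝ) ℂ) with hS
  have hψ0 : ∀ z, ‖ψ z‖ ≤ S ψ := fun z =>
    (norm_schwartz_le ψ z).trans
      ((Finset.le_sup (f := schwartzSeminormFamily ℂ (ℝ × ℝ) ℂ)
        (by simp : ((0, 0) : ℕ × ℕ) ∈ ({(0, 0), (0, 1)} : Finset (ℕ × ℕ)))) ψ)
  have hψ1 : ∀ z, ‖∂_{((1, 0) : ℝ × ℝ)} ψ z‖ ≤ S ψ := fun z => by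
    refine le_trans ?_ ((Finset.le_sup (f := schwartzSeminormFamily ℂ (ℝ × ℝ) ℂ)
        (by simp : ((0, 1) : ℕ × ℕ) ∈ ({(0, 0), (0, 1)} : Finset (ℕ × ℕ)))) ψ)
    rw [SchwartzMap.lineDerivOp_apply_eq_fderiv]
    refine (ContinuousLinearMap.le_opNorm _ _).trans ?_
    have h4 : ‖((1, 0) : ℝ × ℝ)‖ = 1 := by simp [Prod.norm_def]
    rw [h4, mul_one, ← norm_iteratedFDeriv_one]
    simpa using ψ.le_seminorm ℂ 0 1 z
  have hi1 : Integrable fun z => ‖∂_{((1, 0) : ℝ × ℝ)} G z‖ * S ψ :=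
    (SchwartzMap.integrable _).norm.mul_const _
  have hi2 : Integrable fun z => ‖G z‖ * S ψ := G.integrable.norm.mul_const _
  rw [add_mul, ← integral_mul_const, ← integral_mul_const, ← integral_add hi1 hi2,
    lineDerivOp_schwartzMul]
  refine integral_mono (SchwartzMap.integrable _).norm (hi1.add hi2) fun z => ?_
  refine (norm_add_le _ _).trans ?_
  simp only [schwartzMul_apply, norm_mul]
  gcongr
  · exact hψ0 z
  · exact hψ1 z

/-! ### Short-time Fourier transforms of Schwartz functions lie in every `L^q` -/

/-- Elementary interpolation with `L^∞`. It is used with exponents `(2, p)` when `p > 2` and `(p,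
2)` when `p < 2`. -/
theorem lintegral_enorm_rpow_le {X : Type*} [MeasurableSpace X] {μ : Measure X} {f : X → ℂ}
    {M : ℝ≥0∞} (hM : M ≠ ∞) (hf : ∀ x, ‖f x‖ₑ ≤ M) {r p : ℝ} (hr : 0 ≤ r) (hrp : r ≤ p) :
    ∫⁻ x, ‖f x‖ₑ ^ p ∂μ ≤ M ^ (p - r) * ∫⁻ x, ‖f x‖ₑ ^ r ∂μ := by
  rw [← lintegral_const_mul' _ _ (ENNReal.rpow_ne_top_of_nonneg (by linarith) hM)]
  refine lintegral_mono fun x => ?_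
  calc ‖f x‖ₑ ^ p = ‖f x‖ₑ ^ (p - r) * ‖f x‖ₑ ^ r := by
        rw [← ENNReal.rpow_add_of_nonneg _ _ (by linarith) hr, sub_add_cancel]
    _ ≤ M ^ (p - r) * ‖f x‖ₑ ^ r := by
        gcongr
        exact hf x

theorem memLp_of_integrable_of_bounded {X : Type*} [MeasurableSpace X] {μ : Measure X} {f : X → ℂ}
    (hf : Integrable f μ) {B : ℝ} (hB : ∀ x, ‖f x‖ ≤ B) {q : ℝ≥0∞} (hq : 1 ≤ q) :
    MemLp f q μ := by
  by_cases hq' : q = ∞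
  · rw [hq']
    exact memLp_top_of_bound hf.1 B (Eventually.of_forall hB)
  refine ⟨hf.1, ?_⟩
  rw [eLpNorm_lt_top_iff_lintegral_rpow_enorm_lt_top (by positivity) hq']
  have hq1 : 1 ≤ q.toReal := by simpa using ENNReal.toReal_mono hq' hq
  refine (lintegral_enorm_rpow_le (M := ENNReal.ofReal B) ENNReal.ofReal_ne_top
    (fun x => ?_) zero_le_one hq1).trans_lt ?_
  · rw [← ofReal_norm]
    exact ENNReal.ofReal_le_ofReal (hB x)
  · refine ENNReal.mul_lt_top (ENNReal.rpow_lt_top_of_nonneg (by linarith) ENNReal.ofReal_ne_top) ?_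
    simpa [HasFiniteIntegral] using hf.2

/-- Domination of a function on phase space by an integrable bounded function of the position. -/
def PositionDominated (F : (ℝ × ℝ) × (ℝ × ℝ) → ℂ) : Prop :=
  ∃ H : ℝ × ℝ → ℝ, Integrable H ∧ (∃ B, ∀ x, H x ≤ B) ∧ ∀ w, ‖F w‖ ≤ H w.1

theorem PositionDominated.add {F F' : (ℝ × ℝ) × (ℝ × ℝ) → ℂ} (hF : PositionDominated F)
    (hF' : PositionDominated F') : PositionDominated fun w => F w + F' w := by
  obtain ⟨H, h1, ⟨B, h2⟩, h3⟩ := hF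
  obtain ⟨H', h1', ⟨B', h2'⟩, h3'⟩ := hF'
  exact ⟨fun x => H x + H' x, h1.add h1', ⟨B + B', fun x => add_le_add (h2 x) (h2' x)⟩,
    fun w => (norm_add_le _ _).trans (add_le_add (h3 w) (h3' w))⟩

theorem PositionDominated.const_mul {F : (ℝ × ℝ) × (ℝ × ℝ) → ℂ} (hF : PositionDominated F)
    (c : ℂ) : PositionDominated fun w => c * F w := by
  obtain ⟨H, h1, ⟨B, h2⟩, h3⟩ := hF
  refine ⟨fun x => ‖c‖ * H x, h1.const_mul _, ⟨‖c‖ * B, fun x => ?_⟩, fun w => ?_⟩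
  · exact mul_le_mul_of_nonneg_left (h2 x) (norm_nonneg c)
  · rw [norm_mul]
    exact mul_le_mul_of_nonneg_left (h3 w) (norm_nonneg c)

/-- Taking absolute values inside the integral leaves the convolution of `|G|` with the reflected
`|γ|`, which is integrable and bounded. -/
theorem positionDominated_stft (γ G : 𝓢(ℝ × ℝ, ℂ)) :
    PositionDominated (stft γ (schwartzDist G)) := by
  refine ⟨fun x => ∫ z, ‖winProd G γ x z‖, ?_, ⟨_, fun x => integral_norm_winProd_le G γ x⟩,
    fun w => ?_⟩
  · have h := (G.integrable (μ := volume)).norm.integrable_convolution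
      (ContinuousLinearMap.mul ℝ ℝ) (γ.integrable (μ := volume)).norm.comp_neg
    refine h.congr (Eventually.of_forall fun x => ?_)
    simp only [MeasureTheory.convolution, ContinuousLinearMap.mul_apply', winProd_apply, norm_mul,
      RCLike.norm_conj, neg_sub]
  · rw [stft_schwartzDist]
    exact norm_integral_mul_phaseFun_le _ _

/-- Integration by parts trades a linear factor in the frequency for a derivative on `G` or on the
window. Allowing both to vary is what makes the argument iterate. -/
theorem frequency_mul_stft (γ G : 𝓢(ℝ × ℝ, ℂ)) (w : (ℝ × ℝ) × (ℝ × ℝ)) {v : ℝ × ℝ} {d : ℝ}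
    (hd : w.2.1 * v.1 + w.2.2 * v.2 = d) :
    (d : ℂ) * stft γ (schwartzDist G) w = (2 * (Real.pi : ℂ) * Complex.I)⁻¹ *
      (stft γ (schwartzDist (∂_{v} G)) w + stft (∂_{v} γ) (schwartzDist G) w) := by
  have h1 : ∀ z, HasLineDerivAt ℝ (fun z : ℝ × ℝ => -(w.2.1 * z.1 + w.2.2 * z.2)) (-d) z v := by
    intro z
    unfold HasLineDerivAt
    have h : HasDerivAt (fun t : ℝ => -(w.2.1 * z.1 + w.2.2 * z.2) + t * -d) (-d) 0 := by
      simpa using ((hasDerivAt_id (0 : ℝ)).mul_const (-d)).const_add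
        (-(w.2.1 * z.1 + w.2.2 * z.2))
    convert! h using 1
    funext t
    simp [← hd]
    ring
  have hc : Continuous fun z : ℝ × ℝ => -(w.2.1 * z.1 + w.2.2 * z.2) := by fun_prop
  have h2 := mul_integral_mul_phaseFun (winProd G γ w.1) hc h1
  have h3 : ∫ z, ∂_{v} (winProd G γ w.1) z * phaseFun (fun z => -(w.2.1 * z.1 + w.2.2 * z.2)) z
      = stft γ (schwartzDist (∂_{v} G)) w + stft (∂_{v} γ) (schwartzDist G) w := by
    have hi : ∀ U : 𝓢(ℝ × ℝ, ℂ), Integrable fun z => U z *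
        phaseFun (fun z => -(w.2.1 * z.1 + w.2.2 * z.2)) z := fun U =>
      integrable_mul_bounded U (continuous_phaseFun hc) fun z => (norm_phaseFun _ z).le
    rw [stft_schwartzDist, stft_schwartzDist, ← integral_add (hi _) (hi _), lineDerivOp_winProd]
    congr with z
    rw [add_apply]
    ring
  rw [h3, ← stft_schwartzDist] at h2
  have hpi : 2 * (Real.pi : ℂ) * Complex.I ≠ 0 := Complex.two_pi_I_ne_zero
  rw [eq_inv_mul_iff_mul_eq₀ hpi]
  push_cast at h2
  linear_combination -h2

/-- A weight of the frequency that preserves position domination of all short-time Fourier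
transforms of Schwartz functions. -/
def IsFrequencyWeight (m : ℝ × ℝ → ℝ) : Prop :=
  ∀ γ G : 𝓢(ℝ × ℝ, ℂ), PositionDominated fun w => (m w.2 : ℂ) * stft γ (schwartzDist G) w

theorem IsFrequencyWeight.mul_frequency {m : ℝ × ℝ → ℝ} (hm : IsFrequencyWeight m) (v : ℝ × ℝ) :
    IsFrequencyWeight fun ξ => m ξ * (ξ.1 * v.1 + ξ.2 * v.2) := by
  intro γ G
  have h := (((hm γ (∂_{v} G)).add (hm (∂_{v} γ) G))).const_mul (2 * (Real.pi : ℂ) * Complex.I)⁻¹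
  convert h using 2 with w
  rw [Complex.ofReal_mul, mul_assoc, frequency_mul_stft γ G w rfl]
  ring

theorem IsFrequencyWeight.add {m m' : ℝ × ℝ → ℝ} (hm : IsFrequencyWeight m)
    (hm' : IsFrequencyWeight m') : IsFrequencyWeight fun ξ => m ξ + m' ξ := by
  intro γ G
  convert (hm γ G).add (hm' γ G) using 2 with w
  push_cast
  ring

theorem isFrequencyWeight_one : IsFrequencyWeight fun _ => 1 := fun γ G => by
  simpa using positionDominated_stft γ G

theorem isFrequencyWeight_one_add_sq_mul :
    IsFrequencyWeight fun ξ => (1 + ξ.1 ^ 2) * (1 + ξ.2 ^ 2) := by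
  have h1 := (isFrequencyWeight_one.mul_frequency (1, 0)).mul_frequency (1, 0)
  have h2 := (isFrequencyWeight_one.mul_frequency (0, 1)).mul_frequency (0, 1)
  have h3 := (h1.mul_frequency (0, 1)).mul_frequency (0, 1)
  convert ((isFrequencyWeight_one.add h1).add h2).add h3 using 2 with ξ
  simp only [mul_one, mul_zero, add_zero, zero_add]
  ring

/-- The weight `(1 + ξ₁²)(1 + ξ₂²)` yields a majorant that is integrable in position and frequency
separately. Integrability and boundedness then give every exponent `q ≥ 1`. -/
theorem memLp_stft_schwartzDist (γ G : 𝓢(ℝ × ℝ, ℂ)) {q : ℝ≥0∞} (hq : 1 ≤ q) :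
    MemLp (stft γ (schwartzDist G)) q volume := by
  obtain ⟨H, h1, ⟨B, h2⟩, h3⟩ := isFrequencyWeight_one_add_sq_mul γ G
  have hb : ∀ w : (ℝ × ℝ) × (ℝ × ℝ), ‖stft γ (schwartzDist G) w‖
      ≤ H w.1 * ((1 + w.2.1 ^ 2)⁻¹ * (1 + w.2.2 ^ 2)⁻¹) := by
    intro w
    have h := h3 w
    rw [norm_mul, Complex.norm_real, Real.norm_of_nonneg (by positivity)] at h
    rw [← mul_inv, ← div_eq_mul_inv, le_div_iff₀ (by positivity), mul_comm]
    exact h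
  obtain ⟨H', -, ⟨B', h2'⟩, h3'⟩ := positionDominated_stft γ G
  have hi : Integrable fun w : (ℝ × ℝ) × (ℝ × ℝ) =>
      H w.1 * ((1 + w.2.1 ^ 2)⁻¹ * (1 + w.2.2 ^ 2)⁻¹) :=
    h1.mul_prod (integrable_inv_one_add_sq.mul_prod integrable_inv_one_add_sq)
  refine memLp_of_integrable_of_bounded
    (hi.mono' (continuous_stft_schwartzDist γ G).aestronglyMeasurable (Eventually.of_forall hb))
    (B := B') (fun w => (h3' w).trans (h2' _)) hq

theorem eLpNorm_stft_schwartzDist_modul (γ G : 𝓢(ℝ × ℝ, ℂ)) (η : ℝ × ℝ) (q : ℝ≥0∞) :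
    eLpNorm (stft γ (schwartzDist (modul η G))) q volume
      = eLpNorm (stft γ (schwartzDist G)) q volume := by
  have h1 : stft γ (schwartzDist (modul η G))
      = fun w => stft γ (schwartzDist G) (w - ((0, 0), η)) := by
    funext w
    rw [stft_schwartzDist_modul]
    congr 1
    ext <;> simp
  rw [h1]
  have : (volume : Measure ((ℝ × ℝ) × (ℝ × ℝ))).IsAddRightInvariant :=
    Measure.prod.instIsAddRightInvariant
  exact eLpNorm_comp_measurePreserving
    (continuous_stft_schwartzDist γ G).aestronglyMeasurable
    (measurePreserving_sub_right (volume : Measure ((ℝ × ℝ) × (ℝ × ℝ))) ((0, 0), η))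

theorem integral_norm_sq_pos {γ : 𝓢(ℝ × ℝ, ℂ)} (hγ : γ ≠ 0) : 0 < ∫ z, ‖γ z‖ ^ 2 := by
  have hc : Continuous fun z => ‖γ z‖ ^ 2 := by fun_prop
  obtain ⟨z, hz⟩ : ∃ z, γ z ≠ 0 := by
    by_contra! h
    exact hγ (SchwartzMap.ext h)
  have hi : Integrable fun z => ‖γ z‖ ^ 2 := by
    have := (γ.integrable (μ := volume)).norm.mul_bdd (c := SchwartzMap.seminorm ℂ 0 0 γ)
      γ.continuous.norm.aestronglyMeasurable
      (Eventually.of_forall fun z => by simpa using norm_schwartz_le γ z)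
    simpa [sq] using this
  exact integral_pos_of_integrable_nonneg_nonzero hc hi (fun z => by positivity)
    (x := z) (by simpa using hz)

/-- The transform is continuous and its value at the origin is `∫ |γ|² > 0`. -/
theorem eLpNorm_stft_self_ne_zero {γ : 𝓢(ℝ × ℝ, ℂ)} (hγ : γ ≠ 0) {q : ℝ≥0∞} (hq : 1 ≤ q) :
    eLpNorm (stft γ (schwartzDist γ)) q volume ≠ 0 := by
  have hc := continuous_stft_schwartzDist γ γ
  rw [Ne, eLpNorm_eq_zero_iff hc.aestronglyMeasurable (by positivity)]
  intro h
  have h1 := congrFun ((hc.ae_eq_iff_eq volume continuous_zero).1 h) 0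
  rw [stft_schwartzDist] at h1
  have h2 : ∀ z, winProd γ γ (0 : (ℝ × ℝ) × (ℝ × ℝ)).1 z *
      phaseFun (fun z => -((0 : (ℝ × ℝ) × (ℝ × ℝ)).2.1 * z.1 + (0 : (ℝ × ℝ) × (ℝ × ℝ)).2.2 * z.2)) z
      = ((‖γ z‖ ^ 2 : ℝ) : ℂ) := by
    intro z
    simp [winProd_apply, phaseFun, Complex.mul_conj']
  simp only [h2, Pi.zero_apply] at h1
  rw [integral_complex_ofReal, Complex.ofReal_eq_zero] at h1
  exact (integral_norm_sq_pos hγ).ne' h1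

/-! ### The Plancherel formula for the coefficients of `π_λ` -/

/-- The shear `(s, t) ↦ (s - t²/2, t)` of the plane. -/
def shear : (ℝ × ℝ) ≃ₜ (ℝ × ℝ) where
  toFun z := (z.1 - z.2 ^ 2 / 2, z.2)
  invFun z := (z.1 + z.2 ^ 2 / 2, z.2)
  left_inv z := by simp
  right_inv z := by simp

theorem shear_apply (z : ℝ × ℝ) : shear z = (z.1 - z.2 ^ 2 / 2, z.2) := rfl

theorem measurePreserving_shear : MeasurePreserving shear volume volume := by
  -- The shear translates one coordinate by a function of the other. The skew product puts the base
  -- coordinate first, hence the conjugation by the swap.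
  have h : MeasurePreserving (fun z : ℝ × ℝ => (z.1, z.2 - z.1 ^ 2 / 2))
      ((volume : Measure ℝ).prod volume) ((volume : Measure ℝ).prod volume) :=
    (MeasurePreserving.id volume).skew_product (g := fun a b => b - a ^ 2 / 2)
      (by fun_prop) (Eventually.of_forall fun a =>
        (measurePreserving_sub_right (volume : Measure ℝ) (a ^ 2 / 2)).map_eq)
  exact (Measure.measurePreserving_swap.comp (h.comp Measure.measurePreserving_swap))

theorem hasTemperateGrowth_shear : Function.HasTemperateGrowth (shear : ℝ × ℝ → ℝ × ℝ) := by
  have h1 : Function.HasTemperateGrowth fun z : ℝ × ℝ => z :=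
    (ContinuousLinearMap.id ℝ (ℝ × ℝ)).hasTemperateGrowth
  have h2 : Function.HasTemperateGrowth fun z : ℝ × ℝ => (1 / 2 * z.2 ^ 2) • ((1, 0) : ℝ × ℝ) :=
    ((Function.HasTemperateGrowth.const (1 / 2 : ℝ)).mul (hasTemperateGrowth_snd.pow 2)).smul
      (Function.HasTemperateGrowth.const _)
  convert! h1.sub h2 using 1
  funext z
  ext
  · simp [shear_apply]
    ring
  · simp [shear_apply]

/-- The inverse shear grows only quadratically, so composition with the shear preserves Schwartz
functions. -/
theorem norm_le_shear (z : ℝ × ℝ) : ‖z‖ ≤ 1 * (1 + ‖shear z‖) ^ 2 := by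
  have h1 : |z.1 - z.2 ^ 2 / 2| ≤ ‖shear z‖ := norm_fst_le (shear z)
  have h2 : |z.2| ≤ ‖shear z‖ := norm_snd_le (shear z)
  have h3 : z.2 ^ 2 ≤ ‖shear z‖ ^ 2 := by
    rw [← sq_abs]
    exact pow_le_pow_left₀ (abs_nonneg _) h2 2
  have h4 := abs_le.1 h1
  have h5 := norm_nonneg (shear z)
  rw [one_mul, Prod.norm_def, max_le_iff, Real.norm_eq_abs, Real.norm_eq_abs]
  refine ⟨abs_le.2 ⟨by nlinarith [sq_nonneg z.2], by nlinarith⟩, by nlinarith⟩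

/-- A Schwartz function precomposed with the shear, on the Euclidean plane. -/
def shearedSchwartz (U : 𝓢(ℝ × ℝ, ℂ)) : 𝓢(WithLp 2 (ℝ × ℝ), ℂ) :=
  SchwartzMap.compCLMOfContinuousLinearEquiv ℂ (WithLp.prodContinuousLinearEquiv 2 ℝ ℝ ℝ)
    (SchwartzMap.compCLM ℂ hasTemperateGrowth_shear ⟨2, 1, norm_le_shear⟩ U)

theorem shearedSchwartz_apply (U : 𝓢(ℝ × ℝ, ℂ)) (v : WithLp 2 (ℝ × ℝ)) :
    shearedSchwartz U v = U (shear (WithLp.ofLp v)) := rfl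

/-- The Fourier transform of `U` in the coordinates `(s + t²/2, t)`. -/
def shearedFourier (U : 𝓢(ℝ × ℝ, ℂ)) (ξ : ℝ × ℝ) : ℂ :=
  ∫ z, U z * phaseFun (fun z => -(ξ.1 * (z.1 + z.2 ^ 2 / 2) + ξ.2 * z.2)) z

open scoped FourierTransform in
theorem fourier_shearedSchwartz (U : 𝓢(ℝ × ℝ, ℂ)) (ξ : ℝ × ℝ) :
    𝓕 (shearedSchwartz U) (WithLp.toLp 2 ξ) = shearedFourier U ξ := by
  rw [SchwartzMap.fourier_coe, Real.fourier_eq', shearedFourier]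
  rw [← measurePreserving_shear.integral_comp shear.measurableEmbedding,
    ← (WithLp.volume_preserving_ofLp ℝ ℝ).integral_comp
      (MeasurableEquiv.toLp 2 (ℝ × ℝ)).symm.measurableEmbedding]
  congr with v
  rw [shearedSchwartz_apply, smul_eq_mul, mul_comm, phaseFun]
  congr 2
  simp [shear_apply, WithLp.prod_inner_apply]
  ring

/-- Plancherel on the Euclidean plane, transported by the volume-preserving shear and by the
identification with the sup-norm plane. -/
theorem lintegral_enorm_sq_shearedFourier (U : 𝓢(ℝ × ℝ, ℂ)) :
    ∫⁻ ξ, ‖shearedFourier U ξ‖ₑ ^ 2 = ∫⁻ z, ‖U z‖ₑ ^ 2 := by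
  have hp := SchwartzMap.norm_fourier_toL2_eq (shearedSchwartz U)
  rw [SchwartzMap.toLp, SchwartzMap.toLp, Lp.norm_toLp, Lp.norm_toLp,
    ENNReal.toReal_eq_toReal_iff' (SchwartzMap.memLp _ 2 volume).2.ne
      (SchwartzMap.memLp _ 2 volume).2.ne] at hp
  have hsq : ∀ u : 𝓢(WithLp 2 (ℝ × ℝ), ℂ),
      eLpNorm u 2 volume ^ 2 = ∫⁻ v : ℝ × ℝ, ‖u (WithLp.toLp 2 v)‖ₑ ^ 2 := fun u => by
    have h1 := eLpNorm_nnreal_pow_eq_lintegral (f := u) (μ := volume) (p := 2) two_ne_zero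
    norm_cast at h1
    have hu := u.continuous.measurable
    rw [(WithLp.volume_preserving_toLp ℝ ℝ).lintegral_comp (f := fun v => ‖u v‖ₑ ^ 2)
      (by fun_prop)]
    simpa using h1
  have h := congrArg (· ^ 2) hp
  simp only [hsq, fourier_shearedSchwartz, shearedSchwartz_apply] at h
  have hU := U.continuous.measurable
  rw [h, measurePreserving_shear.lintegral_comp (f := fun z => ‖U z‖ₑ ^ 2) (by fun_prop)]

/-- Since `x₄s - x₂t + x₄t²/2 = x₄(s + t²/2) - x₂t`, the phase is linear in the sheared coordinates
up to the constant `λx₃x₄`, which has no effect on the modulus. -/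
theorem norm_coeff_eq_shearedFourier (l : ℝ) (g G : 𝓢(ℝ × ℝ, ℂ)) (w : ℝ × ℝ × ℝ × ℝ) :
    ‖G53.coeff l g (schwartzDist G) (G53.sec w)‖ₑ
      = ‖shearedFourier (winProd G g (w.2.1, w.2.2.2)) (l * w.2.2.1, -(l * w.1))‖ₑ := by
  have h : G53.coeff l g (schwartzDist G) (G53.sec w)
      = phaseFun (fun _ => l * (w.2.1 * w.2.2.1)) 0 *
        shearedFourier (winProd G g (w.2.1, w.2.2.2)) (l * w.2.2.1, -(l * w.1)) := by
    rw [coeff_schwartzDist, shearedFourier, ← integral_const_mul]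
    congr with z
    rw [mul_left_comm]
    congr 1
    have := phaseFun_mul (fun _ => l * (w.2.1 * w.2.2.1))
      (fun z => -(l * w.2.2.1 * (z.1 + z.2 ^ 2 / 2) + -(l * w.1) * z.2)) z
    refine Eq.trans ?_ this.symm
    congr 1
    funext z
    simp only [G53.repPhase, G53.sec]
    ring
  rw [h, enorm_mul, ← ofReal_norm (phaseFun _ _), norm_phaseFun, ENNReal.ofReal_one, one_mul]

/-- The coordinates `((x₃, x₅), (λx₄, -λx₂))` on `G_{5,3}/Z`. -/
def phaseSpaceEquiv (l : ℝ) (hl : l ≠ 0) :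
    (ℝ × ℝ × ℝ × ℝ) ≃L[ℝ] ((ℝ × ℝ) × (ℝ × ℝ)) :=
  LinearEquiv.toContinuousLinearEquiv
    { toFun := fun w => ((w.2.1, w.2.2.2), (l * w.2.2.1, -(l * w.1)))
      invFun := fun v => (-(v.2.2 / l), v.1.1, v.2.1 / l, v.1.2)
      map_add' := fun v w => by ext <;> simp <;> ring
      map_smul' := fun c w => by ext <;> simp <;> ring
      left_inv := fun w => by ext <;> simp <;> field_simp
      right_inv := fun v => by ext <;> simp <;> field_simp }

/-- Uniqueness of Haar measure under a linear isomorphism. Only finiteness and positivity of the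
constant matter, so the Jacobian is not computed. -/
theorem exists_map_phaseSpaceEquiv (l : ℝ) (hl : l ≠ 0) :
    ∃ c : ℝ≥0∞, c ≠ 0 ∧ c ≠ ∞ ∧
      Measure.map (phaseSpaceEquiv l hl) volume = c • (volume : Measure ((ℝ × ℝ) × (ℝ × ℝ))) := by
  have h1 : (volume : Measure ((ℝ × ℝ) × (ℝ × ℝ))).IsAddHaarMeasure :=
    Measure.prod.instIsAddHaarMeasure _ _
  have h2 : (volume : Measure (ℝ × ℝ × ℝ)).IsAddHaarMeasure :=
    Measure.prod.instIsAddHaarMeasure _ _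
  have h3 : (volume : Measure (ℝ × ℝ × ℝ × ℝ)).IsAddHaarMeasure :=
    Measure.prod.instIsAddHaarMeasure _ _
  have h4 : (Measure.map (phaseSpaceEquiv l hl) volume).IsAddHaarMeasure :=
    (phaseSpaceEquiv l hl).isAddHaarMeasure_map volume
  have h := Measure.isAddLeftInvariant_eq_smul
    (Measure.map (phaseSpaceEquiv l hl) volume) (volume : Measure ((ℝ × ℝ) × (ℝ × ℝ)))
  have h5 := Measure.addHaarScalarFactor_pos_of_isAddHaarMeasure
    (Measure.map (phaseSpaceEquiv l hl) volume) (volume : Measure ((ℝ × ℝ) × (ℝ × ℝ)))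
  exact ⟨_, by exact_mod_cast h5.ne', ENNReal.coe_ne_top, h⟩

theorem lintegral_enorm_sq_winProd (g G : 𝓢(ℝ × ℝ, ℂ)) :
    ∫⁻ y, ∫⁻ z, ‖winProd G g y z‖ₑ ^ 2 = (∫⁻ z, ‖G z‖ₑ ^ 2) * ∫⁻ z, ‖g z‖ₑ ^ 2 := by
  have hG : Measurable fun z => ‖G z‖ₑ ^ 2 := by
    have := G.continuous.measurable
    fun_prop
  have hg' : Measurable fun z => ‖g z‖ₑ ^ 2 := by
    have := g.continuous.measurable
    fun_prop
  have h0 : ∀ y z, ‖winProd G g y z‖ₑ ^ 2 = ‖G z‖ₑ ^ 2 * ‖g (z - y)‖ₑ ^ 2 := fun y z => by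
    rw [winProd_apply, enorm_mul, RCLike.enorm_conj, mul_pow]
  simp only [h0]
  rw [lintegral_lintegral_swap]
  · have h1 : ∀ z, ∫⁻ y, ‖G z‖ₑ ^ 2 * ‖g (z - y)‖ₑ ^ 2 = ‖G z‖ₑ ^ 2 * ∫⁻ z, ‖g z‖ₑ ^ 2 := fun z => by
      have h2 : Measurable fun y => ‖g (z - y)‖ₑ ^ 2 :=
        hg'.comp (by fun_prop : Measurable fun y => z - y)
      rw [lintegral_const_mul _ h2,
        lintegral_sub_left_eq_self (fun z => ‖g z‖ₑ ^ 2) z]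
    simp only [h1]
    rw [lintegral_mul_const _ hG]
  · exact ((hG.comp measurable_snd).mul
      (hg'.comp (by fun_prop : Measurable fun p : (ℝ × ℝ) × (ℝ × ℝ) => p.2 - p.1))).aemeasurable

/-- The orthogonality relation of `π_λ` modulo the centre, up to the normalisation of the
measure. -/
theorem exists_lintegral_enorm_sq_coeff (l : ℝ) (hl : l ≠ 0) :
    ∃ c : ℝ≥0∞, c ≠ 0 ∧ c ≠ ∞ ∧ ∀ g G : 𝓢(ℝ × ℝ, ℂ),
      ∫⁻ w, ‖G53.coeff l g (schwartzDist G) (G53.sec w)‖ₑ ^ 2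
        = c * ((∫⁻ z, ‖G z‖ₑ ^ 2) * ∫⁻ z, ‖g z‖ₑ ^ 2) := by
  obtain ⟨c, hc0, hc, hmap⟩ := exists_map_phaseSpaceEquiv l hl
  refine ⟨c, hc0, hc, fun g G => ?_⟩
  have hm : Measurable fun v : (ℝ × ℝ) × (ℝ × ℝ) => ‖shearedFourier (winProd G g v.1) v.2‖ₑ ^ 2 := by
    have : Continuous fun v : (ℝ × ℝ) × (ℝ × ℝ) => shearedFourier (winProd G g v.1) v.2 :=
      continuous_integral_winProd G g continuous_fst (by fun_prop)
    have := this.measurable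
    fun_prop
  simp only [norm_coeff_eq_shearedFourier]
  have h1 := lintegral_map (μ := volume) hm (phaseSpaceEquiv l hl).continuous.measurable
  rw [hmap, lintegral_smul_measure] at h1
  refine h1.symm.trans ?_
  -- Tonelli: for each fixed translation apply Plancherel in the frequency variables, then integrate
  -- over the translations.
  rw [smul_eq_mul, Measure.volume_eq_prod, lintegral_prod _ hm.aemeasurable]
  simp only [lintegral_enorm_sq_shearedFourier, lintegral_enorm_sq_winProd]

/-! ### Comparison of the two scales of spaces -/

theorem lintegral_enorm_sq_ne_top (g : 𝓢(ℝ × ℝ, ℂ)) : ∫⁻ z, ‖g z‖ₑ ^ 2 ≠ ∞ := by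
  have h := (g.memLp 2 volume).2
  rw [eLpNorm_lt_top_iff_lintegral_rpow_enorm_lt_top (by norm_num) (by norm_num)] at h
  simpa using h.ne

theorem lintegral_enorm_sq_ne_zero {g : 𝓢(ℝ × ℝ, ℂ)} (hg : g ≠ 0) : ∫⁻ z, ‖g z‖ₑ ^ 2 ≠ 0 := by
  have hm := g.continuous.measurable
  rw [Ne, lintegral_eq_zero_iff (by fun_prop)]
  intro h
  have h1 : (g : ℝ × ℝ → ℂ) =ᵐ[volume] fun _ => 0 := by
    filter_upwards [h] with z hz
    simpa using hz
  have h2 := (g.continuous.ae_eq_iff_eq volume continuous_const).1 h1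
  exact hg (SchwartzMap.ext fun z => congrFun h2 z)

theorem lintegral_enorm_sq_modul (ξ : ℝ × ℝ) (G : 𝓢(ℝ × ℝ, ℂ)) :
    ∫⁻ z, ‖modul ξ G z‖ₑ ^ 2 = ∫⁻ z, ‖G z‖ₑ ^ 2 := by
  congr with z
  rw [modul_eq, enorm_mul, ← ofReal_norm (phaseFun _ _), norm_phaseFun, ENNReal.ofReal_one, one_mul]

/-- The coefficient functions of the modulations of `G` along the first frequency axis have a
fixed positive `L²` norm and tend to zero uniformly. -/
theorem exists_coeff_modul_bounds {l : ℝ} (hl : l ≠ 0) {g G : 𝓢(ℝ × ℝ, ℂ)} (hg : g ≠ 0)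
    (hG : G ≠ 0) : ∃ (A : ℝ≥0∞) (M : ℕ → ℝ≥0∞), A ≠ 0 ∧ A ≠ ∞ ∧ (∀ k, M k ≠ ∞) ∧
      Tendsto M atTop (𝓝 0) ∧ ∀ k : ℕ,
        ∫⁻ w, ‖G53.coeff l g (schwartzDist (modul ((k : ℝ) + 1, 0) G)) (G53.sec w)‖ₑ ^ (2 : ℝ) = A ∧
        ∀ w, ‖G53.coeff l g (schwartzDist (modul ((k : ℝ) + 1, 0) G)) (G53.sec w)‖ₑ ≤ M k := by
  obtain ⟨c, hc0, hc, h⟩ := exists_lintegral_enorm_sq_coeff l hl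
  obtain ⟨C, hC, hb⟩ := exists_norm_coeff_modul_le l g G
  refine ⟨c * ((∫⁻ z, ‖G z‖ₑ ^ 2) * ∫⁻ z, ‖g z‖ₑ ^ 2), fun k => ENNReal.ofReal (C / √((k : ℝ) + 1)),
    ?_, ?_, fun k => ENNReal.ofReal_ne_top, ?_, fun k => ⟨?_, fun w => ?_⟩⟩
  · exact mul_ne_zero hc0
      (mul_ne_zero (lintegral_enorm_sq_ne_zero hG) (lintegral_enorm_sq_ne_zero hg))
  · exact ENNReal.mul_ne_top hc
      (ENNReal.mul_ne_top (lintegral_enorm_sq_ne_top G) (lintegral_enorm_sq_ne_top g))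
  · rw [← ENNReal.ofReal_zero]
    refine ENNReal.tendsto_ofReal (Tendsto.div_atTop tendsto_const_nhds ?_)
    exact Real.tendsto_sqrt_atTop.comp
      (tendsto_atTop_add_const_right _ _ tendsto_natCast_atTop_atTop)
  · simp only [ENNReal.rpow_two]
    rw [h, lintegral_enorm_sq_modul]
  · rw [← ofReal_norm]
    refine ENNReal.ofReal_le_ofReal (hb _ ?_ _)
    have : (0 : ℝ) ≤ k := k.cast_nonneg
    linarith

/-- For `p > 2` the coefficient functions of modulated Schwartz functions tend to zero in `L^p`. -/
theorem tendsto_eLpNorm_coeff_modul {l : ℝ} (hl : l ≠ 0) {g G : 𝓢(ℝ × ℝ, ℂ)} (hg : g ≠ 0)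
    (hG : G ≠ 0) {p : ℝ≥0∞} (hp : 2 < p) :
    Tendsto (fun k : ℕ => eLpNorm (fun w => G53.coeff l g
      (schwartzDist (modul ((k : ℝ) + 1, 0) G)) (G53.sec w)) p volume) atTop (𝓝 0) := by
  obtain ⟨A, M, -, hA, hM, hM0, h⟩ := exists_coeff_modul_bounds hl hg hG
  by_cases hp' : p = ∞
  · refine tendsto_of_tendsto_of_tendsto_of_le_of_le tendsto_const_nhds hM0
      (fun _ => zero_le) fun k => ?_
    rw [hp', eLpNorm_exponent_top]
    exact eLpNormEssSup_le_of_ae_enorm_bound (Eventually.of_forall (h k).2)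
  · have hr : 2 < p.toReal := by
      simpa using (ENNReal.toReal_lt_toReal (by norm_num) hp').2 hp
    have hlim : Tendsto (fun k => (M k ^ (p.toReal - 2) * A) ^ (1 / p.toReal)) atTop (𝓝 0) := by
      have h1 := (ENNReal.continuous_rpow_const (y := p.toReal - 2)).tendsto 0 |>.comp hM0
      rw [ENNReal.zero_rpow_of_pos (by linarith)] at h1
      have h2 := ENNReal.Tendsto.mul_const h1 (Or.inr hA)
      rw [zero_mul] at h2
      have h3 := (ENNReal.continuous_rpow_const (y := 1 / p.toReal)).tendsto 0 |>.comp h2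
      rw [ENNReal.zero_rpow_of_pos (by positivity)] at h3
      exact h3
    refine tendsto_of_tendsto_of_tendsto_of_le_of_le tendsto_const_nhds hlim
      (fun _ => zero_le) fun k => ?_
    rw [eLpNorm_eq_lintegral_rpow_enorm_toReal (by positivity) hp']
    gcongr
    refine (lintegral_enorm_rpow_le (hM k) (h k).2 zero_le_two hr.le).trans_eq ?_
    rw [(h k).1]

/-- For `p < 2` the coefficient functions of modulated Schwartz functions are unbounded in
`L^p`. -/
theorem not_exists_eLpNorm_coeff_modul_le {l : ℝ} (hl : l ≠ 0) {g G : 𝓢(ℝ × ℝ, ℂ)} (hg : g ≠ 0)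
    (hG : G ≠ 0) {p : ℝ≥0∞} (hp1 : 1 ≤ p) (hp : p < 2) :
    ¬ ∃ B : ℝ≥0, ∀ k : ℕ, eLpNorm (fun w => G53.coeff l g
      (schwartzDist (modul ((k : ℝ) + 1, 0) G)) (G53.sec w)) p volume ≤ B := by
  rintro ⟨B, hB⟩
  obtain ⟨A, M, hA0, -, hM, hM0, h⟩ := exists_coeff_modul_bounds hl hg hG
  have hp' : p ≠ ∞ := (hp.trans (by norm_num)).ne
  have hr : p.toReal < 2 := by
    simpa using (ENNReal.toReal_lt_toReal hp' (by norm_num)).2 hp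
  have hr1 : 0 < p.toReal := ENNReal.toReal_pos (by positivity) hp'
  -- Interpolation read backwards: the fixed `L²` mass is at most a vanishing power of the sup norm
  -- times the bounded `L^p` quantity.
  have hle : ∀ k, A ≤ M k ^ (2 - p.toReal) * (B : ℝ≥0∞) ^ p.toReal := fun k => by
    rw [← (h k).1]
    refine (lintegral_enorm_rpow_le (hM k) (h k).2 hr1.le hr.le).trans ?_
    gcongr
    have h1 := hB k
    rw [eLpNorm_eq_lintegral_rpow_enorm_toReal (by positivity) hp', one_div,
      ENNReal.rpow_inv_le_iff hr1] at h1
    exact h1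
  have h1 := (ENNReal.continuous_rpow_const (y := 2 - p.toReal)).tendsto 0 |>.comp hM0
  rw [ENNReal.zero_rpow_of_pos (by linarith)] at h1
  have h2 := ENNReal.Tendsto.mul_const h1
    (Or.inr (ENNReal.rpow_ne_top_of_nonneg hr1.le (ENNReal.coe_ne_top (r := B))))
  rw [zero_mul] at h2
  exact hA0 (le_antisymm (ge_of_tendsto' h2 hle) zero_le)

/-! ### Failure of the inclusions -/

theorem stft_eq_apply (γ : 𝓢(ℝ × ℝ, ℂ)) (f : 𝓢'(ℝ × ℝ, ℂ)) (w : (ℝ × ℝ) × (ℝ × ℝ)) :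
    stft γ f w = f (schwartzConj (modul w.2 (transl w.1 γ))) := rfl

theorem coeff_sec_eq_apply (l : ℝ) (g : 𝓢(ℝ × ℝ, ℂ)) (f : 𝓢'(ℝ × ℝ, ℂ)) (w : ℝ × ℝ × ℝ × ℝ) :
    (fun f w => G53.coeff l g f (G53.sec w)) f w = f (schwartzConj (G53.rep l (G53.sec w) g)) := rfl

/-- Boundedness of coefficient functions under an inclusion of a modulation space in a coorbit
space. -/
theorem exists_eLpNorm_coeff_le_of_imp {l : ℝ} {g γ : 𝓢(ℝ × ℝ, ℂ)} {p q : ℝ≥0∞} (hp : 1 ≤ p)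
    (hq : 1 ≤ q) (F : ℕ → 𝓢'(ℝ × ℝ, ℂ)) (N : Finset (ℕ × ℕ)) (C : ℝ) (hC : 0 ≤ C)
    (hN : ∀ k ψ, ‖F k ψ‖ ≤ C * N.sup (schwartzSeminormFamily ℂ (ℝ × ℝ) ℂ) ψ)
    (hF : ∀ k, MemLp (stft γ (F k)) q volume) (B : ℝ≥0)
    (hB : ∀ k, eLpNorm (stft γ (F k)) q volume ≤ B)
    (h : ∀ f, MemLp (stft γ f) q volume →
      MemLp (fun w => G53.coeff l g f (G53.sec w)) p volume) :
    ∃ B' : ℝ≥0, ∀ k, eLpNorm (fun w => G53.coeff l g (F k) (G53.sec w)) p volume ≤ B' :=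
  exists_eLpNorm_le_of_memLp_imp (V := stft γ)
    (W := fun f w => G53.coeff l g f (G53.sec w)) hq hp F N C hC hN
    (stft_eq_apply γ) (coeff_sec_eq_apply l g) hF B hB h

/-- Boundedness of short-time Fourier transforms under an inclusion of a coorbit space in a
modulation space. -/
theorem exists_eLpNorm_stft_le_of_imp {l : ℝ} {g γ : 𝓢(ℝ × ℝ, ℂ)} {p q : ℝ≥0∞} (hp : 1 ≤ p)
    (hq : 1 ≤ q) (F : ℕ → 𝓢'(ℝ × ℝ, ℂ)) (N : Finset (ℕ × ℕ)) (C : ℝ) (hC : 0 ≤ C)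
    (hN : ∀ k ψ, ‖F k ψ‖ ≤ C * N.sup (schwartzSeminormFamily ℂ (ℝ × ℝ) ℂ) ψ)
    (hF : ∀ k, MemLp (fun w => G53.coeff l g (F k) (G53.sec w)) p volume) (B : ℝ≥0)
    (hB : ∀ k, eLpNorm (fun w => G53.coeff l g (F k) (G53.sec w)) p volume ≤ B)
    (h : ∀ f, MemLp (fun w => G53.coeff l g f (G53.sec w)) p volume →
      MemLp (stft γ f) q volume) :
    ∃ B' : ℝ≥0, ∀ k, eLpNorm (stft γ (F k)) q volume ≤ B' :=
  exists_eLpNorm_le_of_memLp_imp (V := fun f w => G53.coeff l g f (G53.sec w))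
    (W := stft γ) hp hq F N C hC hN
    (coeff_sec_eq_apply l g) (stft_eq_apply γ) hF B hB h

theorem stft_smul (γ : 𝓢(ℝ × ℝ, ℂ)) (c : ℂ) (f : 𝓢'(ℝ × ℝ, ℂ)) :
    stft γ (c • f) = c • stft γ f := rfl

theorem coeff_smul (l : ℝ) (g : 𝓢(ℝ × ℝ, ℂ)) (c : ℂ) (f : 𝓢'(ℝ × ℝ, ℂ)) :
    (fun w => G53.coeff l g (c • f) (G53.sec w))
      = c • fun w => G53.coeff l g f (G53.sec w) := rfl

/-- For `p < 2` no modulation space is contained in the coorbit space. -/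
theorem not_stft_imp_coeff {l : ℝ} (hl : l ≠ 0) {p q : ℝ≥0∞} (hp : 1 ≤ p) (hq : 1 ≤ q)
    (hp2 : p < 2) {g γ : 𝓢(ℝ × ℝ, ℂ)} (hg : g ≠ 0) (hγ : γ ≠ 0) :
    ¬ ∀ f, MemLp (stft γ f) q volume →
      MemLp (fun w => G53.coeff l g f (G53.sec w)) p volume := by
  intro h
  obtain ⟨C, hC, hequi⟩ := exists_norm_schwartzDist_modul_le γ
  -- The shift by one keeps the modulation parameter at least one, so the decay rate `1/k` implies
  -- plain equicontinuity.
  have hk1 : ∀ k : ℕ, (1 : ℝ) ≤ (k : ℝ) + 1 := fun k => by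
    have : (0 : ℝ) ≤ k := k.cast_nonneg
    linarith
  have hE : eLpNorm (stft γ (schwartzDist γ)) q volume ≠ ∞ :=
    (memLp_stft_schwartzDist γ γ hq).2.ne
  refine not_exists_eLpNorm_coeff_modul_le hl hg hγ hp hp2
    (exists_eLpNorm_coeff_le_of_imp hp hq
      (fun k : ℕ => schwartzDist (modul ((k : ℝ) + 1, 0) γ)) {(0, 0), (0, 1)} C hC
      (fun k ψ => ?_) (fun k => memLp_stft_schwartzDist γ (modul ((k : ℝ) + 1, 0) γ) hq)
      (eLpNorm (stft γ (schwartzDist γ)) q volume).toNNReal (fun k => ?_) h)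
  · refine le_trans ?_ (hequi _ (zero_lt_one.trans_le (hk1 k)) ψ)
    exact le_mul_of_one_le_left (norm_nonneg _) (hk1 k)
  · rw [ENNReal.coe_toNNReal hE]
    exact (eLpNorm_stft_schwartzDist_modul γ γ _ q).le

/-- For `p > 2` the coorbit space is contained in no modulation space. -/
theorem not_coeff_imp_stft {l : ℝ} (hl : l ≠ 0) {p q : ℝ≥0∞} (hq : 1 ≤ q)
    (hp2 : 2 < p) {g γ : 𝓢(ℝ × ℝ, ℂ)} (hg : g ≠ 0) (hγ : γ ≠ 0) :
    ¬ ∀ f, MemLp (fun w => G53.coeff l g f (G53.sec w)) p volume →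
      MemLp (stft γ f) q volume := by
  intro h
  have hp : 1 ≤ p := le_trans (by norm_num) hp2.le
  obtain ⟨C, hC, hequi⟩ := exists_norm_schwartzDist_modul_le γ
  -- The requirement `j ≤ k` ensures that the factor `j + 1` introduced below is absorbed by the
  -- weak decay of the modulations.
  have hsmall : ∀ j : ℕ, ∃ k : ℕ, j ≤ k ∧ eLpNorm (fun w => G53.coeff l g
      (schwartzDist (modul ((k : ℝ) + 1, 0) γ)) (G53.sec w)) p volume ≤ ((j : ℝ≥0∞) + 1)⁻¹ := by
    intro j
    have h1 := (tendsto_eLpNorm_coeff_modul hl hg hγ hp2).eventually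
      (ge_mem_nhds (show 0 < ((j : ℝ≥0∞) + 1)⁻¹ from ENNReal.inv_pos.2 (by finiteness)))
    obtain ⟨k, hk, hk'⟩ := (h1.and (eventually_ge_atTop j)).exists
    exact ⟨k, hk', hk⟩
  choose κ hκ hκ' using hsmall
  have hnorm : ∀ j : ℕ, ‖((j : ℂ) + 1)‖ = (j : ℝ) + 1 := fun j => by
    have : ((j : ℂ) + 1) = ((j + 1 : ℕ) : ℂ) := by push_cast; rfl
    rw [this, Complex.norm_natCast]
    push_cast
    rfl
  have hsm : ∀ j : ℕ, ‖((j : ℂ) + 1)‖ₑ = (j : ℝ≥0∞) + 1 := fun j => by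
    rw [← ofReal_norm, hnorm, ENNReal.ofReal_add (by positivity) zero_le_one,
      ENNReal.ofReal_natCast, ENNReal.ofReal_one]
  let F : ℕ → 𝓢'(ℝ × ℝ, ℂ) := fun j =>
    ((j : ℂ) + 1) • schwartzDist (modul ((κ j : ℝ) + 1, 0) γ)
  have hinv : ∀ j : ℕ,
      eLpNorm (fun w => G53.coeff l g (F j) (G53.sec w)) p volume ≤ (1 : ℝ≥0) := by
    intro j
    rw [coeff_smul, eLpNorm_const_smul, hsm]
    refine (mul_le_mul_right (hκ' j) _).trans ?_
    rw [ENNReal.coe_one]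
    exact ENNReal.mul_inv_le_one _
  obtain ⟨B, hB⟩ := exists_eLpNorm_stft_le_of_imp hp hq F {(0, 0), (0, 1)} C hC
    (fun j ψ => by
      have hk : (j : ℝ) ≤ κ j := by exact_mod_cast hκ j
      refine le_trans ?_ (hequi ((κ j : ℝ) + 1) (by positivity) ψ)
      refine (norm_smul ((j : ℂ) + 1) (schwartzDist (modul ((κ j : ℝ) + 1, 0) γ) ψ)).trans_le ?_
      rw [hnorm]
      gcongr)
    (fun j => ⟨((continuous_coeff_schwartzDist l g
      (modul ((κ j : ℝ) + 1, 0) γ)).const_smul ((j : ℂ) + 1)).aestronglyMeasurable,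
      (hinv j).trans_lt ENNReal.coe_lt_top⟩) 1 hinv h
  -- Modulation does not change the `M^q` norm, so the rescaled sequence has norms growing linearly
  -- in `j`, against the uniform bound `B`.
  have hB' : ∀ j : ℕ, ((j : ℝ≥0∞) + 1) * eLpNorm (stft γ (schwartzDist γ)) q volume ≤ B := by
    intro j
    have h1 := hB j
    rw [stft_smul, eLpNorm_const_smul, hsm, eLpNorm_stft_schwartzDist_modul] at h1
    exact h1
  obtain ⟨n, hn⟩ := ENNReal.exists_nat_mul_gt (eLpNorm_stft_self_ne_zero hγ hq)
    (ENNReal.coe_ne_top (r := B))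
  refine absurd (hB' n) (not_le.2 (hn.trans_le ?_))
  gcongr
  exact le_self_add

end

theorem mainTheorem2 (l : ℝ) (hl : l ≠ 0) (p q : ℝ≥0∞) (hp : 1 ≤ p) (hq : 1 ≤ q) (hp2 : p ≠ 2)
    (g : 𝓢(ℝ × ℝ, ℂ)) (hg : g ≠ 0) (γ : 𝓢(ℝ × ℝ, ℂ)) (hγ : γ ≠ 0) :
    G53.coorbitSpace l g p ≠ modulationSpace γ q := by
  intro heq
  have hmem : ∀ f, MemLp (fun w => G53.coeff l g f (G53.sec w)) p volume ↔
      MemLp (stft γ f) q volume := fun f => SetLike.ext_iff.1 heq f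
  rcases lt_or_gt_of_ne hp2 with hlt | hgt
  · exact not_stft_imp_coeff hl hp hq hlt hg hγ fun f => (hmem f).2
  · exact not_coeff_imp_stft hl hq hgt hg hγ fun f => (hmem f).1
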